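/- A relational structure consists of a set (its universe) together with finitely many named relations of fixed finite arities on it; the names with their arities form its signature. A tree is a relational structure with one binary relation $\sqsubseteq$ (the ancestor relation) and finitely many unary label relations, such that $\sqsubseteq$ is a (reflexive partial) order with a least element (the root) and, for every node $u$, the set $\{v : v\sqsubseteq u\}$ is well ordered by $\sqsubseteq$ with order type at most $\omega$ (nodes may have arbitrarily many children). First-order formulas are built from relation atoms and equalities by Boolean connectives and quantification over elements; monadic (second-order) formulas may in addition quantify over subsets of the universe and use atoms $x\in X$. A monadic (respectively first-order) interpretation $\mathcal I$ from one signature to another, with relation names $R_1,\dots,R_k$, is a tuple $(\delta(x),\varphi_1(x_1,\dots,x_{|R_1|}),\dots,\varphi_k(x_1,\dots,x_{|R_k|}))$ of monadic (respectively first-order) formulas over the first signature with the indicated free variables, $|R_i|$ being the arity of $R_i$. It maps a structure $S$ with universe $U$ to the structure $\mathcal I(S)$ with universe $\{u\in U : S\models\delta(u)\}$ in which $R_i$ is interpreted as the set of tuples $(u_1,\dots,u_{|R_i|})$ of elements of this universe such that $S\models\varphi_i(u_1,\dots,u_{|R_i|})$. A monadic marking is a monadic interpretation that keeps the whole universe and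 all the relations of the structure unchanged and adds finitely many new unary relations, each defined by a monadic formula with one free element variable. Theorem. For every monadic interpretation $\mathcal I_{\mathrm{MSO}}$ from a signature of trees to a finite relational signature, there exist a monadic marking $\mathcal M_{\mathrm{MSO}}$ and a first-order interpretation $\mathcal I_{\mathrm{FO}}$ (which may use the ancestor relation, the labels and the new unary relations) such that for every tree $t$ over that signature of trees, $$\mathcal I_{\mathrm{MSO}}(t)=\mathcal I_{\mathrm{FO}}(\mathcal M_{\mathrm{MSO}}(t)).$$ -/

import Mathlib

namespace TreeInterp

open FirstOrder

universe u

/-! ### Relational structures -/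

/-- Signatures are Mathlib's first-order languages without function symbols (`L.IsRelational`).
A relational structure over the signature `L`: a set `univ` (its universe, a subset
of some ambient type `α`) and, for each relation name `R` of arity `n`, a set of `n`-tuples of
elements of the universe. Keeping the universe as a set makes equality of structures literal. -/
@[ext]
structure RelStructure (L : FirstOrder.Language.{0, 0}) (α : Type u) where
  univ : Set α
  rel : ∀ {n : ℕ}, L.Relations n → Set (Fin n → α)
  rel_subset : ∀ {n : ℕ} (R : L.Relations n), ∀ x ∈ rel R, ∀ i, x i ∈ univ

variable {L : FirstOrder.Language.{0, 0}} {α : Type u}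

/-- The universe of a relational structure, as a Mathlib first-order structure. -/
instance RelStructure.toStructure [L.IsRelational] (S : RelStructure L α) : L.Structure S.univ where
  funMap f := isEmptyElim f
  RelMap R x := (fun i => (x i : α)) ∈ S.rel R

/-! ### Monadic second-order logic -/

/-- Monadic second-order formulas with `n` first-order variables and `m` monadic variables in
scope. The remaining connectives and quantifiers are expressible from `falsum`, `imp`, `all` and
`allSet`, as for Mathlib's first-order formulas. -/
inductive MSO (L : FirstOrder.Language.{0, 0}) : ℕ → ℕ → Type
  | falsum {n m : ℕ} : MSO L n m
  | equal {n m : ℕ} (i j : Fin n) : MSO L n m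
  | rel {n m k : ℕ} (R : L.Relations k) (x : Fin k → Fin n) : MSO L n m
  | mem {n m : ℕ} (i : Fin n) (X : Fin m) : MSO L n m
  | imp {n m : ℕ} (φ ψ : MSO L n m) : MSO L n m
  | all {n m : ℕ} (φ : MSO L (n + 1) m) : MSO L n m
  | allSet {n m : ℕ} (φ : MSO L n (m + 1)) : MSO L n m

/-- Satisfaction of a monadic formula in `U`: first-order variables take values in `U`, monadic
variables take subsets of `U` as values. A quantifier binds the last variable in scope. -/
def MSO.Realize (U : Type u) [L.Structure U] :
    ∀ {n m : ℕ}, MSO L n m → (Fin n → U) → (Fin m → Set U) → Prop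
  | _, _, .falsum, _, _ => False
  | _, _, .equal i j, x, _ => x i = x j
  | _, _, .rel R y, x, _ => FirstOrder.Language.Structure.RelMap R (fun i => x (y i))
  | _, _, .mem i X, x, Y => x i ∈ Y X
  | _, _, .imp φ ψ, x, Y => φ.Realize U x Y → ψ.Realize U x Y
  | _, _, .all φ, x, Y => ∀ a : U, φ.Realize U (Fin.snoc x a : Fin (_ + 1) → U) Y
  | _, _, .allSet φ, x, Y => ∀ A : Set U, φ.Realize U x (Fin.snoc Y A : Fin (_ + 1) → Set U)

/-! ### Interpretations -/

/-- The structure defined inside `S` by a unary predicate `δ` on the universe of `S` and, for each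
relation name `R` of `L'` of arity `n`, an `n`-ary predicate `φ R` on the universe of `S`: its
universe is the set of elements satisfying `δ`, and `R` is interpreted as the set of tuples of such
elements that satisfy `φ R`. -/
def RelStructure.defined (S : RelStructure L α) (L' : FirstOrder.Language.{0, 0})
    (δ : (Fin 1 → S.univ) → Prop) (φ : ∀ {n : ℕ}, L'.Relations n → (Fin n → S.univ) → Prop) :
    RelStructure L' α where
  univ := {a | ∃ h : a ∈ S.univ, δ (fun _ => ⟨a, h⟩)}
  rel {n} R := {x | ∃ h : ∀ i : Fin n, x i ∈ S.univ,
    (∀ i, δ (fun _ => ⟨x i, h i⟩)) ∧ φ R (fun i => ⟨x i, h i⟩)}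
  rel_subset := by
    rintro n R x ⟨h, hδ, -⟩ i
    exact ⟨h i, hδ i⟩

/-- A monadic interpretation from signature `L` to signature `L'`. -/
structure MSOInterpretation (L : FirstOrder.Language.{0, 0}) (L' : FirstOrder.Language.{0, 0}) where
  dom : MSO L 1 0
  rel : ∀ {n : ℕ}, L'.Relations n → MSO L n 0

/-- A first-order interpretation from signature `L` to signature `L'`. -/
structure FOInterpretation (L : FirstOrder.Language.{0, 0}) (L' : FirstOrder.Language.{0, 0}) where
  dom : L.Formula (Fin 1)
  rel : ∀ {n : ℕ}, L'.Relations n → L.Formula (Fin n)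

/-- The structure `I(S)`, for a monadic interpretation `I`. -/
def MSOInterpretation.apply [L.IsRelational] {L' : FirstOrder.Language.{0, 0}} (I : MSOInterpretation L L')
    (S : RelStructure L α) : RelStructure L' α :=
  S.defined L' (fun x => I.dom.Realize S.univ x Fin.elim0)
    (fun R x => (I.rel R).Realize S.univ x Fin.elim0)

/-- The structure `I(S)`, for a first-order interpretation `I`. -/
def FOInterpretation.apply [L.IsRelational] {L' : FirstOrder.Language.{0, 0}} (I : FOInterpretation L L')
    (S : RelStructure L α) : RelStructure L' α :=
  S.defined L' (fun x => I.dom.Realize x) (fun R x => (I.rel R).Realize x)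

/-! ### Markings -/

/-- Unary relation names indexed by `A`. -/
inductive UnaryRel (A : Type) : ℕ → Type
  | mk (a : A) : UnaryRel A 1

/-- The relational signature that consists of one unary relation name for each element of `A`. -/
def unary (A : Type) : FirstOrder.Language.{0, 0} := ⟨fun _ => Empty, UnaryRel A⟩

instance (A : Type) : (unary A).IsRelational := fun _ => inferInstanceAs (IsEmpty Empty)

/-- A monadic marking of structures over `L`, with one new unary relation for each element of `B`,
is given by a monadic formula with one free first-order variable for each `b : B`. -/
structure MSOMarking (L : FirstOrder.Language.{0, 0}) (B : Type) where
  mark : B → MSO L 1 0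

/-- A marking is the monadic interpretation that keeps all elements of the universe, replicates the
relations of `L`, and adds the new unary relations. -/
def MSOMarking.toInterpretation {B : Type} (M : MSOMarking L B) :
    MSOInterpretation L (L.sum (unary B)) where
  dom := .imp .falsum .falsum
  rel := fun {_} R => match R with
    | .inl R => .rel R id
    | .inr (.mk b) => M.mark b

/-! ### Trees -/

/-- The signature of trees with labels in `A`: the ancestor relation (the symbol of Mathlib's
language of orders) and a unary label relation for each element of `A`. -/
abbrev treeSig (A : Type) : FirstOrder.Language.{0, 0} := FirstOrder.Language.order.sum (unary A)

/-- `t.Anc x y` means `x ⊑ y`: `x` is an ancestor of `y` or equal to `y`. -/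
def RelStructure.Anc {A : Type} (t : RelStructure (treeSig A) α) (x y : α) : Prop :=
  ![x, y] ∈ t.rel (Sum.inl FirstOrder.Language.orderRel.le : (treeSig A).Relations 2)

/-- A structure over `treeSig A` is a tree if `⊑` is an order on its universe, with a least element
(the root), such that the set of `v ⊑ u`, for each node `u`, is well ordered by the strict relation,
of order type at most `ω`. The label relations are arbitrary. -/
structure IsTree {A : Type} (t : RelStructure (treeSig A) α) : Prop where
  refl : ∀ x ∈ t.univ, t.Anc x x
  antisymm : ∀ x y, t.Anc x y → t.Anc y x → x = y
  trans : ∀ x y z, t.Anc x y → t.Anc y z → t.Anc x z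
  root : ∃ r ∈ t.univ, ∀ x ∈ t.univ, t.Anc r x
  ordinal : ∀ u ∈ t.univ,
    ∃ _ : IsWellOrder {x // t.Anc x u} (fun x y => t.Anc x.1 y.1 ∧ x ≠ y),
      Ordinal.type (fun x y : {x // t.Anc x u} => t.Anc x.1 y.1 ∧ x ≠ y) ≤ Ordinal.omega0

end TreeInterp

namespace TreeInterp

universe u

/-! The core is `fm_of_mdef`: over forests, a monadic predicate with finitely many, and at least
one, free element variables is first-order definable from unary monadic predicates. A definition
uses only finitely many of these, and the marking records them.

A monadic predicate is decided by the monadic type, of some finite rank, of the whole forest with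
its arguments as singletons (`MDef.exists_tp`). Types compose: when a piece is attached above a
"port" of another piece, the types of the pieces determine the type of the union (`tp_union`). So
the forest is cut into pieces whose types should be unary properties of single nodes. For pairs of
nodes, two kinds of pieces resist.

For `x < y` it is the segment between them. Its type is a product of types along a path, which
first-order logic cannot evaluate in general (it may count modulo 2). Composition on the right is
read as a deterministic automaton with types as states, and each node carries a bijection from
states to slots, chosen such that the slot of a run never increases (`exists_slot_step`). A run
therefore changes its slot boundedly often and a first-order formula can follow it (`Track.fm`),
while the slots and their moves are unary monadic information (`mdef_slots`, `mdef_slotMove`). This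
yields `fm_segType`.

For incomparable nodes it is what remains after removing the cones of the two siblings `c` and `d`
below them. Its type depends on `d` only through the type of the cone of `d` (`restType_congr`), so
`c` can carry it as a mark.

Longer tuples are handled by induction, splitting the tuple at a node `c`. The marks needed in the
resulting subforest are binary predicates of `c` and an element, so the binary case supplies them
(`FM.relativize`). -/

/-! ### Forests -/

/-- A forest: a partial order in which the elements below each element form a finite chain. -/
structure Forest : Type (u + 1) where
  carrier : Type u
  order : PartialOrder carrier
  finite_Iic : ∀ x : carrier, {y | order.le y x}.Finite
  chain : ∀ x y z : carrier, order.le x z → order.le y z → order.le x y ∨ order.le y x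

namespace Forest

instance : CoeSort Forest.{u} (Type u) := ⟨Forest.carrier⟩

instance (T : Forest.{u}) : PartialOrder T := T.order

/-- The forest induced on a subset. -/
def sub (T : Forest.{u}) (V : Set T) : Forest.{u} where
  carrier := V
  order := inferInstance
  finite_Iic x := Set.Finite.of_finite_image ((T.finite_Iic x.1).subset (by
    rintro _ ⟨y, hy, rfl⟩
    exact hy)) Subtype.val_injective.injOn
  chain x y z := T.chain x.1 y.1 z.1

variable {T : Forest.{u}}

theorem le_total_of_le {x y z : T} (hx : x ≤ z) (hy : y ≤ z) : x ≤ y ∨ y ≤ x :=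
  T.chain x y z hx hy

theorem finite_setOf_le (x : T) : {y : T | y ≤ x}.Finite := T.finite_Iic x

/-- The number of elements below serves as the measure. -/
theorem lt_wf : WellFounded (fun x y : T => x < y) := by
  have h : ∀ n : ℕ, ∀ x : T, (finite_setOf_le x).toFinset.card ≤ n →
      Acc (fun x y : T => x < y) x := by
    intro n
    induction n with
    | zero =>
      intro x hx
      have : x ∈ (finite_setOf_le x).toFinset := by simp
      simp_all
    | succ n ih =>
      intro x hx
      refine ⟨_, fun y hy => ih y (Nat.le_of_lt_succ (lt_of_lt_of_le (Finset.card_lt_card ?_) hx))⟩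
      rw [Finset.ssubset_iff_of_subset]
      · exact ⟨x, by simp, by simpa using hy.not_ge⟩
      · intro z hz
        simp only [Set.Finite.mem_toFinset, Set.mem_ofPred_eq] at hz ⊢
        exact hz.trans hy.le
  exact ⟨fun x => h _ x le_rfl⟩

theorem exists_minimal_le {p : T → Prop} {x : T} (hx : p x) :
    ∃ c, c ≤ x ∧ p c ∧ ∀ d, d < c → ¬ p d := by
  induction x using lt_wf.induction with
  | _ x ih =>
    by_cases h : ∃ d, d < x ∧ p d
    · obtain ⟨d, hd, hp⟩ := h
      obtain ⟨c, hc, h⟩ := ih d hd hp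
      exact ⟨c, hc.trans hd.le, h⟩
    · exact ⟨x, le_rfl, hx, fun d hd hp => h ⟨d, hd, hp⟩⟩

/-- The child of `x` towards `y`. -/
theorem exists_covBy_le {x y : T} (h : x < y) : ∃ z, x ⋖ z ∧ z ≤ y := by
  obtain ⟨c, hc, hxc, hmin⟩ := exists_minimal_le (p := fun c => x < c) h
  exact ⟨c, ⟨hxc, fun d hxd hdc => hmin d hdc hxd⟩, hc⟩

/-- The parent of `y`, below which `x` lies. -/
theorem exists_le_covBy {x y : T} (h : x < y) : ∃ p, x ≤ p ∧ p ⋖ y := by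
  have hne : {z : T | z < y}.Nonempty := ⟨x, h⟩
  have hfin : {z : T | z < y}.Finite := (finite_setOf_le y).subset fun z hz => le_of_lt hz
  obtain ⟨p, hp⟩ := hfin.exists_maximal hne
  have hpy : p < y := hp.1
  have hmax : ∀ z, z < y → z ≤ p := fun z hz =>
    (le_total_of_le hz.le hpy.le).elim id (hp.2 hz)
  exact ⟨p, hmax x h, hpy, fun z hpz hzy => (hmax z hzy).not_gt hpz⟩

theorem parent_unique {p q y : T} (hp : p ⋖ y) (hq : q ⋖ y) : p = q := by
  rcases le_total_of_le hp.lt.le hq.lt.le with h | h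
  · exact h.eq_or_lt.resolve_right fun h => hp.2 h hq.lt
  · exact (h.eq_or_lt.resolve_right fun h => hq.2 h hp.lt).symm

theorem le_parent {p y z : T} (hp : p ⋖ y) (hz : z < y) : z ≤ p := by
  rcases le_total_of_le hp.lt.le hz.le with h | h
  · exact (h.eq_or_lt.resolve_right fun h => hp.2 h hz).ge
  · exact h

end Forest

/-! ### Monadic types -/

/-- Adds one value to a family. -/
def cons {ι : Type} {X : Type*} (a : X) (x : ι → X) : Option ι → X
  | none => a
  | some i => x i

@[simp] theorem cons_none {ι : Type} {X : Type*} (a : X) (x : ι → X) : cons a x none = a := rfl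

@[simp] theorem cons_some {ι : Type} {X : Type*} (a : X) (x : ι → X) (i : ι) :
    cons a x (some i) = x i := rfl

theorem cons_comp_map {ι ι' : Type} {X : Type*} (a : X) (x : ι → X) (f : ι' → ι) :
    cons a x ∘ Option.map f = cons a (x ∘ f) := by
  funext o
  cases o <;> rfl

/-- Atomic statements on a family of sets indexed by `ι`, and a further set, the port. -/
inductive Atom (ι : Type) : Type
  | le (i j : ι)
  | meet (i j : ι)
  | multi (i : ι)
  | port (i : ι)

instance {ι : Type} [Finite ι] : Finite (Atom ι) := by
  let f : (ι × ι) ⊕ (ι × ι) ⊕ ι ⊕ ι → Atom ι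
    | .inl (i, j) => .le i j
    | .inr (.inl (i, j)) => .meet i j
    | .inr (.inr (.inl i)) => .multi i
    | .inr (.inr (.inr i)) => .port i
  refine Finite.of_surjective f ?_
  rintro (⟨i, j⟩ | ⟨i, j⟩ | i | i)
  exacts [⟨.inl (i, j), rfl⟩, ⟨.inr (.inl (i, j)), rfl⟩, ⟨.inr (.inr (.inl i)), rfl⟩,
    ⟨.inr (.inr (.inr i)), rfl⟩]

/-- Truth of an atomic statement relative to the subset `V` with port `P`. -/
def Atom.Holds {T : Type*} {ι : Type} [LE T] (V P : Set T) (Y : ι → Set T) : Atom ι → Prop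
  | .le i j => ∃ x y, (x ∈ V ∧ x ∈ Y i) ∧ (y ∈ V ∧ y ∈ Y j) ∧ x ≤ y
  | .meet i j => ∃ x ∈ V, x ∈ Y i ∧ x ∈ Y j
  | .multi i => ∃ x y, (x ∈ V ∧ x ∈ Y i) ∧ (y ∈ V ∧ y ∈ Y i) ∧ x ≠ y
  | .port i => ∃ x ∈ V, x ∈ Y i ∧ x ∈ P

/-- Monadic types of rank `k` for families of sets indexed by `ι`. -/
def Tp : ℕ → Type → Type
  | 0, ι => Set (Atom ι)
  | k + 1, ι => Set (Tp k (Option ι))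

/-- Membership of an atomic statement in a type of rank `0`. -/
def Tp.Has {ι : Type} (s : Tp 0 ι) (a : Atom ι) : Prop := Membership.mem (γ := Set (Atom ι)) s a

instance Tp.finite : ∀ (k : ℕ) (ι : Type) [Finite ι], Finite (Tp k ι)
  | 0, ι, _ => inferInstanceAs (Finite (Set (Atom ι)))
  | k + 1, ι, _ =>
    have := Tp.finite k (Option ι)
    inferInstanceAs (Finite (Set (Tp k (Option ι))))

/-- The monadic type of rank `k` of the family `Y` in the suborder `V` with port `P`. -/
def tp {T : Type*} [LE T] : ∀ (k : ℕ) {ι : Type} (_V _P : Set T) (_Y : ι → Set T), Tp k ι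
  | 0, _, V, P, Y => {a : Atom _ | a.Holds V P Y}
  | k + 1, _, V, P, Y => Set.range fun Z : Set T => tp k V P (cons Z Y)

/-! ### Locality, reindexing and composition of types -/

section

variable {T : Type*} [LE T] {ι : Type}

/-- Only the traces on `V` enter a type. This is what allows a singleton that lies in another piece
to be replaced by `∅`. -/
theorem tp_congr (k : ℕ) {ι : Type} {V P P' : Set T} {Y Y' : ι → Set T}
    (hP : ∀ x ∈ V, x ∈ P ↔ x ∈ P') (hY : ∀ i, ∀ x ∈ V, x ∈ Y i ↔ x ∈ Y' i) :
    tp k V P Y = tp k V P' Y' := by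
  induction k generalizing ι with
  | zero =>
    have h : ∀ i x, (x ∈ V ∧ x ∈ Y i) ↔ (x ∈ V ∧ x ∈ Y' i) := fun i x => and_congr_right (hY i x)
    refine Set.ext fun a => ?_
    change a.Holds V P Y ↔ a.Holds V P' Y'
    cases a with
    | le i j => simp only [Atom.Holds, h]
    | meet i j =>
      exact exists_congr fun x => and_congr_right fun hx => and_congr (hY i x hx) (hY j x hx)
    | multi i => simp only [Atom.Holds, h]
    | port i =>
      exact exists_congr fun x => and_congr_right fun hx => and_congr (hY i x hx) (hP x hx)
  | succ k ih =>
    refine congrArg Set.range (funext fun Z => ih ?_)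
    rintro (_ | i) x hx
    exacts [Iff.rfl, hY i x hx]

/-- Reindexing of types. -/
def Tp.map : ∀ (k : ℕ) {ι ι' : Type} (_f : ι' → ι), Tp k ι → Tp k ι'
  | 0, _, ι', f, s => {a : Atom ι' | match a with
    | .le i j => s.Has (.le (f i) (f j))
    | .meet i j => s.Has (.meet (f i) (f j))
    | .multi i => s.Has (.multi (f i))
    | .port i => s.Has (.port (f i))}
  | k + 1, _, _, f, s => Tp.map k (Option.map f) '' s

theorem map_tp (k : ℕ) {ι ι' : Type} (f : ι' → ι) (V P : Set T) (Y : ι → Set T) :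
    (tp k V P Y).map k f = tp k V P (Y ∘ f) := by
  induction k generalizing ι ι' with
  | zero =>
    refine Set.ext fun a => ?_
    cases a <;> exact Iff.rfl
  | succ k ih =>
    change Tp.map k (Option.map f) '' Set.range _ = Set.range _
    rw [← Set.range_comp]
    refine congrArg Set.range (funext fun Z => ?_)
    rw [Function.comp_apply, ih, cons_comp_map]

/-- Removal of the port. -/
def Tp.forget : ∀ (k : ℕ) {ι : Type}, Tp k ι → Tp k ι
  | 0, ι, s => {a : Atom ι | match a with
    | .port _ => False
    | a => s.Has a}
  | k + 1, _, s => Tp.forget k '' s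

theorem forget_tp (k : ℕ) {ι : Type} (V P : Set T) (Y : ι → Set T) :
    (tp k V P Y).forget k = tp k V ∅ Y := by
  induction k generalizing ι with
  | zero =>
    refine Set.ext fun a => ?_
    cases a
    · exact Iff.rfl
    · exact Iff.rfl
    · exact Iff.rfl
    · change False ↔ ∃ x ∈ V, _ ∧ x ∈ (∅ : Set T)
      simp
  | succ k ih =>
    change Tp.forget k '' Set.range _ = Set.range _
    rw [← Set.range_comp]
    exact congrArg Set.range (funext fun Z => ih _)

/-- Composition of types: the second part is put on top of the port of the first part. -/
def Tp.comp : ∀ (k : ℕ) {ι : Type}, Tp k ι → Tp k ι → Tp k ι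
  | 0, ι, s, t => {a : Atom ι | s.Has a ∨ t.Has a ∨ match a with
    | .le i j => s.Has (.port i) ∧ t.Has (.meet j j)
    | .multi i => s.Has (.meet i i) ∧ t.Has (.meet i i)
    | _ => False}
  | k + 1, _, s, t => Set.image2 (Tp.comp k) s t

/-- All elements of `W` see the same elements of `V`, namely the port, so atoms across the two
pieces reduce to `port` and `meet` atoms inside each piece. In higher rank, a subset of the union is
an independent choice of a subset of each piece. -/
theorem tp_union (k : ℕ) {ι : Type} {V W P : Set T} (Y : ι → Set T)
    (hd : Disjoint V W) (hle : ∀ v ∈ V, ∀ w ∈ W, v ≤ w ↔ v ∈ P)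
    (hge : ∀ v ∈ V, ∀ w ∈ W, ¬ w ≤ v) :
    tp k (V ∪ W) P Y = (tp k V P Y).comp k (tp k W P Y) := by
  have hd' : ∀ v ∈ V, v ∉ W := fun v hv hw => Set.disjoint_left.1 hd hv hw
  induction k generalizing ι with
  | zero =>
    refine Set.ext fun a => ?_
    cases a with
    | le i j =>
      change (∃ x y, _) ↔ (∃ x y, _) ∨ (∃ x y, _) ∨ (∃ x ∈ V, _) ∧ (∃ x ∈ W, _)
      constructor
      · rintro ⟨x, y, ⟨hx | hx, hxi⟩, ⟨hy | hy, hyj⟩, hxy⟩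
        · exact .inl ⟨x, y, ⟨hx, hxi⟩, ⟨hy, hyj⟩, hxy⟩
        · exact .inr (.inr ⟨⟨x, hx, hxi, (hle x hx y hy).1 hxy⟩, ⟨y, hy, hyj, hyj⟩⟩)
        · exact (hge y hy x hx hxy).elim
        · exact .inr (.inl ⟨x, y, ⟨hx, hxi⟩, ⟨hy, hyj⟩, hxy⟩)
      · rintro (⟨x, y, ⟨hx, hxi⟩, ⟨hy, hyj⟩, hxy⟩ | ⟨x, y, ⟨hx, hxi⟩, ⟨hy, hyj⟩, hxy⟩ |
          ⟨⟨x, hx, hxi, hxP⟩, ⟨y, hy, hyj, -⟩⟩)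
        · exact ⟨x, y, ⟨.inl hx, hxi⟩, ⟨.inl hy, hyj⟩, hxy⟩
        · exact ⟨x, y, ⟨.inr hx, hxi⟩, ⟨.inr hy, hyj⟩, hxy⟩
        · exact ⟨x, y, ⟨.inl hx, hxi⟩, ⟨.inr hy, hyj⟩, (hle x hx y hy).2 hxP⟩
    | meet i j =>
      change (∃ x ∈ V ∪ W, _) ↔ (∃ x ∈ V, _) ∨ (∃ x ∈ W, _) ∨ False
      simp only [Set.mem_union, or_and_right, exists_or, or_false]
    | multi i =>
      change (∃ x y, _) ↔ (∃ x y, _) ∨ (∃ x y, _) ∨ (∃ x ∈ V, _) ∧ (∃ x ∈ W, _)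
      constructor
      · rintro ⟨x, y, ⟨hx | hx, hxi⟩, ⟨hy | hy, hyj⟩, hxy⟩
        · exact .inl ⟨x, y, ⟨hx, hxi⟩, ⟨hy, hyj⟩, hxy⟩
        · exact .inr (.inr ⟨⟨x, hx, hxi, hxi⟩, ⟨y, hy, hyj, hyj⟩⟩)
        · exact .inr (.inr ⟨⟨y, hy, hyj, hyj⟩, ⟨x, hx, hxi, hxi⟩⟩)
        · exact .inr (.inl ⟨x, y, ⟨hx, hxi⟩, ⟨hy, hyj⟩, hxy⟩)
      · rintro (⟨x, y, ⟨hx, hxi⟩, ⟨hy, hyj⟩, hxy⟩ | ⟨x, y, ⟨hx, hxi⟩, ⟨hy, hyj⟩, hxy⟩ |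
          ⟨⟨x, hx, hxi, -⟩, ⟨y, hy, hyj, -⟩⟩)
        · exact ⟨x, y, ⟨.inl hx, hxi⟩, ⟨.inl hy, hyj⟩, hxy⟩
        · exact ⟨x, y, ⟨.inr hx, hxi⟩, ⟨.inr hy, hyj⟩, hxy⟩
        · refine ⟨x, y, ⟨.inl hx, hxi⟩, ⟨.inr hy, hyj⟩, ?_⟩
          rintro rfl
          exact hd' x hx hy
    | port i =>
      change (∃ x ∈ V ∪ W, _) ↔ (∃ x ∈ V, _) ∨ (∃ x ∈ W, _) ∨ False
      simp only [Set.mem_union, or_and_right, exists_or, or_false]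
  | succ k ih =>
    change Set.range _ = Set.image2 _ (Set.range _) (Set.range _)
    rw [Set.image2_range]
    refine Set.ext fun σ => ?_
    constructor
    · rintro ⟨Z, rfl⟩
      exact ⟨(Z, Z), (ih _).symm⟩
    · rintro ⟨⟨Z, Z'⟩, rfl⟩
      refine ⟨{x | (x ∈ V ∧ x ∈ Z) ∨ (x ∈ W ∧ x ∈ Z')}, ?_⟩
      dsimp only
      rw [ih]
      congr 1
      · refine tp_congr k (fun _ _ => Iff.rfl) ?_
        rintro (_ | i) x hx
        · simp [hx, hd' x hx]
        · rfl
      · refine tp_congr k (fun _ _ => Iff.rfl) ?_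
        rintro (_ | i) x hx
        · simp [hx, show x ∉ V from fun h => hd' x h hx]
        · rfl

end

/-- Subsets of the subforest are traces of subsets of `T`. This brings statements about induced
forests back to relative types in `T`. -/
theorem tp_sub (k : ℕ) {ι : Type} {T : Forest.{u}} (V P : Set T) (Y : ι → Set T) :
    tp k (Set.univ : Set (T.sub V)) {x : T.sub V | x.1 ∈ P} (fun i => {x : T.sub V | x.1 ∈ Y i}) =
      tp k V P Y := by
  have hle : ∀ x y : T.sub V, x ≤ y ↔ x.1 ≤ y.1 := fun _ _ => Iff.rfl
  induction k generalizing ι with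
  | zero =>
    refine Set.ext fun a => ?_
    cases a with
    | le i j =>
      constructor
      · rintro ⟨x, y, ⟨-, hx⟩, ⟨-, hy⟩, hxy⟩
        exact ⟨x.1, y.1, ⟨x.2, hx⟩, ⟨y.2, hy⟩, hxy⟩
      · rintro ⟨x, y, ⟨hxV, hx⟩, ⟨hyV, hy⟩, hxy⟩
        exact ⟨⟨x, hxV⟩, ⟨y, hyV⟩, ⟨trivial, hx⟩, ⟨trivial, hy⟩, hxy⟩
    | meet i j =>
      constructor
      · rintro ⟨x, -, h⟩
        exact ⟨x.1, x.2, h⟩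
      · rintro ⟨x, hx, h⟩
        exact ⟨⟨x, hx⟩, trivial, h⟩
    | multi i =>
      constructor
      · rintro ⟨x, y, ⟨-, hx⟩, ⟨-, hy⟩, hxy⟩
        exact ⟨x.1, y.1, ⟨x.2, hx⟩, ⟨y.2, hy⟩, fun h => hxy (Subtype.ext h)⟩
      · rintro ⟨x, y, ⟨hxV, hx⟩, ⟨hyV, hy⟩, hxy⟩
        exact ⟨⟨x, hxV⟩, ⟨y, hyV⟩, ⟨trivial, hx⟩, ⟨trivial, hy⟩,
          fun h => hxy (congrArg Subtype.val h)⟩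
    | port i =>
      constructor
      · rintro ⟨x, -, h⟩
        exact ⟨x.1, x.2, h⟩
      · rintro ⟨x, hx, h⟩
        exact ⟨⟨x, hx⟩, trivial, h⟩
  | succ k ih =>
    refine Set.ext fun σ => ?_
    constructor
    · rintro ⟨Z, rfl⟩
      refine ⟨Subtype.val '' Z, ?_⟩
      dsimp only
      rw [← ih]
      refine tp_congr k (fun _ _ => Iff.rfl) ?_
      rintro (_ | i) x -
      · constructor
        · rintro ⟨y, hy, h⟩
          rwa [← Subtype.ext h]
        · exact fun h => ⟨x, h, rfl⟩
      · rfl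
    · rintro ⟨Z, rfl⟩
      refine ⟨{x | x.1 ∈ Z}, ?_⟩
      dsimp only
      rw [← ih]
      refine tp_congr k (fun _ _ => Iff.rfl) ?_
      rintro (_ | i) x - <;> rfl

/-! ### Definable predicates on forests -/

/-- A predicate on elements and subsets of a forest. -/
abbrev Pred (ι κ : Type) : Type (u + 1) :=
  ∀ T : Forest.{u}, (ι → T) → (κ → Set T) → Prop

/-- The predicates definable from order, membership and the unary predicates in `mk`. Quantifiers
over sets are available if `so` holds. -/
inductive Definable (so : Prop) (mk : ∀ κ : Type, Pred.{u} Unit κ → Prop) :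
    ∀ {ι κ : Type}, Pred.{u} ι κ → Prop
  | falsum {ι κ : Type} : Definable so mk (fun _ (_ : ι → _) (_ : κ → _) => False)
  | le {ι κ : Type} (i j : ι) : Definable so mk (fun _ x (_ : κ → _) => x i ≤ x j)
  | mem {ι κ : Type} (i : ι) (l : κ) : Definable so mk (fun _ x Y => x i ∈ Y l)
  | mark {ι κ : Type} {μ : Pred Unit κ} (h : mk κ μ) (i : ι) :
      Definable so mk (fun T x Y => μ T (fun _ => x i) Y)
  | imp {ι κ : Type} {Φ Ψ : Pred ι κ} (hΦ : Definable so mk Φ) (hΨ : Definable so mk Ψ) :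
      Definable so mk (fun T x Y => Φ T x Y → Ψ T x Y)
  | cons_all {ι κ : Type} {Φ : Pred (Option ι) κ} (hΦ : Definable so mk Φ) :
      Definable so mk (fun T (x : ι → T) Y => ∀ a, Φ T (cons a x) Y)
  | cons_allSet {ι κ : Type} {Φ : Pred ι (Option κ)} (hso : so) (hΦ : Definable so mk Φ) :
      Definable so mk (fun T x (Y : κ → Set T) => ∀ Z, Φ T x (cons Z Y))

/-- The predicates definable in monadic second-order logic. -/
abbrev MDef {ι κ : Type} (Φ : Pred.{u} ι κ) : Prop := Definable True (fun _ _ => False) Φ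

/-- The predicates definable in first-order logic from unary monadic predicates. -/
abbrev FM {ι κ : Type} (Φ : Pred.{u} ι κ) : Prop := Definable False (fun _ μ => MDef μ) Φ

/-! ### Closure properties of definability -/

namespace Definable

variable {so : Prop} {mk : ∀ κ : Type, Pred.{u} Unit κ → Prop} {ι κ : Type} {Φ Ψ : Pred.{u} ι κ}

theorem congr (hΦ : Definable so mk Φ) (h : ∀ T x Y, Ψ T x Y ↔ Φ T x Y) : Definable so mk Ψ := by
  have : Ψ = Φ := by
    funext T x Y
    exact propext (h T x Y)
  rwa [this]

theorem mono {so' : Prop} {mk' : ∀ κ : Type, Pred.{u} Unit κ → Prop} (hs : so → so')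
    (hm : ∀ κ μ, mk κ μ → mk' κ μ) (hΦ : Definable so mk Φ) : Definable so' mk' Φ := by
  induction hΦ with
  | falsum => exact falsum
  | le i j => exact le i j
  | mem i l => exact mem i l
  | mark h i => exact mark (hm _ _ h) i
  | imp _ _ h₁ h₂ => exact h₁.imp h₂
  | cons_all _ h => exact h.cons_all
  | cons_allSet hso _ h => exact h.cons_allSet (hs hso)

theorem all {Φ : ∀ T : Forest.{u}, (ι → T) → T → (κ → Set T) → Prop}
    (h : Definable so mk (fun T (x : Option ι → T) Y => Φ T (fun i => x (some i)) (x none) Y)) :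
    Definable so mk (fun T x Y => ∀ a, Φ T x a Y) :=
  h.cons_all

theorem allSet (hso : so) {Φ : ∀ T : Forest.{u}, (ι → T) → (κ → Set T) → Set T → Prop}
    (h : Definable so mk
      (fun T x (Y : Option κ → Set T) => Φ T x (fun l => Y (some l)) (Y none))) :
    Definable so mk (fun T x Y => ∀ Z, Φ T x Y Z) :=
  h.cons_allSet hso

theorem not (h : Definable so mk Φ) : Definable so mk (fun T x Y => ¬ Φ T x Y) :=
  h.imp falsum

theorem const (p : Prop) : Definable so mk (fun _ (_ : ι → _) (_ : κ → _) => p) := by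
  by_cases hp : p
  · exact (falsum.imp falsum).congr fun _ _ _ => by simp [hp]
  · exact falsum.congr fun _ _ _ => by simp [hp]

theorem and (h₁ : Definable so mk Φ) (h₂ : Definable so mk Ψ) :
    Definable so mk (fun T x Y => Φ T x Y ∧ Ψ T x Y) :=
  (h₁.imp h₂.not).not.congr fun _ _ _ => by tauto

theorem or (h₁ : Definable so mk Φ) (h₂ : Definable so mk Ψ) :
    Definable so mk (fun T x Y => Φ T x Y ∨ Ψ T x Y) :=
  (h₁.not.imp h₂).congr fun _ _ _ => by tauto

theorem iff (h₁ : Definable so mk Φ) (h₂ : Definable so mk Ψ) :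
    Definable so mk (fun T x Y => Φ T x Y ↔ Ψ T x Y) :=
  ((h₁.imp h₂).and (h₂.imp h₁)).congr fun _ _ _ => by tauto

theorem ex {Φ : ∀ T : Forest.{u}, (ι → T) → T → (κ → Set T) → Prop}
    (h : Definable so mk (fun T (x : Option ι → T) Y => Φ T (fun i => x (some i)) (x none) Y)) :
    Definable so mk (fun T x Y => ∃ a, Φ T x a Y) :=
  (all (Φ := fun T x a Y => ¬ Φ T x a Y) h.not).not.congr fun _ _ _ => by simp

theorem exSet (hso : so) {Φ : ∀ T : Forest.{u}, (ι → T) → (κ → Set T) → Set T → Prop}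
    (h : Definable so mk
      (fun T x (Y : Option κ → Set T) => Φ T x (fun l => Y (some l)) (Y none))) :
    Definable so mk (fun T x Y => ∃ Z, Φ T x Y Z) :=
  (allSet hso (Φ := fun T x Y Z => ¬ Φ T x Y Z) h.not).not.congr fun _ _ _ => by simp

theorem all_finset {C : Type*} {Φ : C → Pred.{u} ι κ} (s : Finset C)
    (h : ∀ c, Definable so mk (Φ c)) :
    Definable so mk (fun T x Y => ∀ c ∈ s, Φ c T x Y) := by
  classical
  induction s using Finset.induction_on with
  | empty => exact (const True).congr fun _ _ _ => by simp
  | insert a s _ ih => exact ((h a).and ih).congr fun _ _ _ => by simp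

theorem all_finite {C : Type*} [Finite C] {Φ : C → Pred.{u} ι κ}
    (h : ∀ c, Definable so mk (Φ c)) : Definable so mk (fun T x Y => ∀ c, Φ c T x Y) := by
  have := Fintype.ofFinite C
  exact (all_finset Finset.univ h).congr fun _ _ _ => by simp

theorem ex_finite {C : Type*} [Finite C] {Φ : C → Pred.{u} ι κ}
    (h : ∀ c, Definable so mk (Φ c)) : Definable so mk (fun T x Y => ∃ c, Φ c T x Y) :=
  (all_finite fun c => (h c).not).not.congr fun _ _ _ => by simp

theorem reindex {ι' : Type} (f : ι → ι') (hΦ : Definable so mk Φ) :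
    Definable so mk (fun T (x : ι' → T) Y => Φ T (fun i => x (f i)) Y) := by
  induction hΦ generalizing ι' with
  | falsum => exact falsum
  | le i j => exact le (f i) (f j)
  | mem i l => exact mem (f i) l
  | mark h i => exact mark h (f i)
  | imp _ _ h₁ h₂ => exact (h₁ f).imp (h₂ f)
  | cons_all _ h =>
    refine (h (Option.map f)).cons_all.congr fun T x Y => forall_congr' fun a => ?_
    rw [show (fun o => cons a x (Option.map f o)) = cons a (fun i => x (f i)) from
      cons_comp_map a x f]
  | cons_allSet hso _ h => exact (h f).cons_allSet hso

theorem lt (i j : ι) : Definable so mk (fun T x (_ : κ → Set T) => x i < x j) :=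
  ((le i j).and (le j i).not).congr fun _ _ _ => lt_iff_le_not_ge

theorem eq (i j : ι) : Definable so mk (fun T x (_ : κ → Set T) => x i = x j) :=
  ((le i j).and (le j i)).congr fun _ _ _ => le_antisymm_iff

theorem covBy (i j : ι) : Definable so mk (fun T x (_ : κ → Set T) => x i ⋖ x j) :=
  (lt i j).and (all ((lt (some i) none).imp (lt none (some j)).not))

end Definable

open Definable

/-! ### Definability of types, and types deciding monadic predicates -/

section MDef

variable {ι κ : Type} {Φ Ψ : Pred.{u} ι κ}

/-- Monadic definitions contain no marks. For a general `mk` this argument breaks, since a mark need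
not remain one after its set parameters are renamed. -/
theorem MDef.reindexSets {κ' : Type} (g : κ → κ') (hΦ : MDef Φ) :
    MDef (fun T x (Y : κ' → Set T) => Φ T x (fun l => Y (g l))) := by
  unfold MDef at hΦ
  induction hΦ generalizing κ' with
  | falsum => exact falsum
  | le i j => exact le i j
  | mem i l => exact mem i (g l)
  | mark h i => exact h.elim
  | imp _ _ h₁ h₂ => exact (h₁ g).imp (h₂ g)
  | cons_all _ h => exact (h g).cons_all
  | cons_allSet hso _ h =>
    refine ((h (Option.map g)).cons_allSet hso).congr fun T x Y => forall_congr' fun Z => ?_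
    rw [show (fun o => cons Z Y (Option.map g o)) = cons Z (fun l => Y (g l)) from
      cons_comp_map Z Y g]

theorem MDef.fm {μ : Pred.{u} Unit κ} (h : MDef μ) (i : ι) :
    FM (fun T x Y => μ T (fun _ => x i) Y) :=
  mark h i

/-- A monadically definable set, with parameters. -/
def DSet (V : ∀ T : Forest.{u}, (ι → T) → (κ → Set T) → Set T) : Prop :=
  MDef (fun T (x : Option ι → T) Y => x none ∈ V T (fun i => x (some i)) Y)

variable {V P : ∀ T : Forest.{u}, (ι → T) → (κ → Set T) → Set T}

theorem DSet.mem (h : DSet V) (i : ι) : MDef (fun T x Y => x i ∈ V T x Y) :=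
  (Definable.reindex (fun o => o.elim i id) h)

theorem DSet.reindex {ι' : Type} (f : ι → ι') (h : DSet V) :
    DSet (fun T (x : ι' → T) Y => V T (fun i => x (f i)) Y) :=
  (Definable.reindex (Option.map f) h)

theorem DSet.reindexSets {κ' : Type} (g : κ → κ') (h : DSet V) :
    DSet (fun T x (Y : κ' → Set T) => V T x (fun l => Y (g l))) :=
  MDef.reindexSets g h

theorem DSet.var (l : κ) : DSet (fun T (_ : ι → T) Y => Y l) :=
  Definable.mem none l

theorem DSet.empty : DSet (fun T (_ : ι → T) (_ : κ → Set T) => ∅) :=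
  falsum

theorem DSet.univ : DSet (fun T (_ : ι → T) (_ : κ → Set T) => Set.univ) :=
  const True

theorem DSet.Ici (i : ι) : DSet (fun T x (_ : κ → Set T) => Set.Ici (x i)) :=
  Definable.le (some i) none

theorem DSet.Iio (i : ι) : DSet (fun T x (_ : κ → Set T) => Set.Iio (x i)) :=
  Definable.lt none (some i)

theorem DSet.singleton (i : ι) : DSet (fun T x (_ : κ → Set T) => {x i}) :=
  Definable.eq none (some i)

theorem DSet.diff (h : DSet V) (h' : DSet P) : DSet (fun T x Y => V T x Y \ P T x Y) :=
  h.and (Definable.not h')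

/-- Monadic types relative to definable sets are definable. -/
theorem mdef_tp (k : ℕ) {ι κ l : Type} [Finite l]
    {V P : ∀ T : Forest.{u}, (ι → T) → (κ → Set T) → Set T} (hV : DSet V) (hP : DSet P)
    {Z : ∀ T : Forest.{u}, (ι → T) → (κ → Set T) → l → Set T}
    (hZ : ∀ i, DSet (fun T x Y => Z T x Y i)) (τ : Tp k l) :
    MDef (fun T x Y => tp k (V T x Y) (P T x Y) (Z T x Y) = τ) := by
  induction k generalizing κ l with
  | zero =>
    -- A type is a subset of a finite set, so fixing it is a finite conjunction with one equivalence
    -- per possible member. The same holds in higher rank.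
    suffices h : ∀ a : Atom l, MDef (fun T x Y => a.Holds (V T x Y) (P T x Y) (Z T x Y)) from
      (all_finite fun a => (h a).iff (const (τ.Has a))).congr fun T x Y => Set.ext_iff
    rintro (⟨i, j⟩ | ⟨i, j⟩ | i | i)
    · exact ex (ex (
        (((hV.reindex (fun i => some (some i))).mem (some none)).and
          (((hZ i).reindex (fun i => some (some i))).mem (some none))).and
        ((((hV.reindex (fun i => some (some i))).mem none).and
          (((hZ j).reindex (fun i => some (some i))).mem none)).and
        (Definable.le (some none) none))))
    · exact ex (((hV.reindex some).mem none).and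
        ((((hZ i).reindex some).mem none).and (((hZ j).reindex some).mem none)))
    · exact ex (ex (
        (((hV.reindex (fun i => some (some i))).mem (some none)).and
          (((hZ i).reindex (fun i => some (some i))).mem (some none))).and
        ((((hV.reindex (fun i => some (some i))).mem none).and
          (((hZ i).reindex (fun i => some (some i))).mem none)).and
        (Definable.eq (some none) none).not)))
    · exact ex (((hV.reindex some).mem none).and
        ((((hZ i).reindex some).mem none).and ((hP.reindex some).mem none)))
  | succ k ih =>
    refine (all_finite (C := Tp k (Option l))
      (Φ := fun σ T x Y => (∃ W : Set T, tp k (V T x Y) (P T x Y) (cons W (Z T x Y)) = σ) ↔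
        Membership.mem (γ := Set (Tp k (Option l))) τ σ) fun σ => ?_).congr
      fun T x Y => Set.ext_iff
    refine (exSet trivial ?_).iff (const _)
    refine ih (hV.reindexSets some) (hP.reindexSets some)
      (Z := fun T x Y => cons (Y none) (Z T x fun l => Y (some l))) ?_ σ
    rintro (_ | i)
    · exact DSet.var none
    · exact (hZ i).reindexSets some

/-- The members of a type of rank `k + 1` are types of expansions by one set. There is at least one,
and forgetting the added set in any of them gives back the type of rank `k`. -/
theorem exists_raise (k : ℕ) {ι : Type} (F : Set (Tp k ι)) :
    ∃ F' : Set (Tp (k + 1) ι), ∀ (T : Forest.{u}) (V P : Set T) (Y : ι → Set T),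
      tp k V P Y ∈ F ↔ tp (k + 1) V P Y ∈ F' := by
  refine ⟨{τ | ∃ σ : Tp k (Option ι), Membership.mem (γ := Set (Tp k (Option ι))) τ σ ∧
    σ.map k some ∈ F}, fun T V P Y => ?_⟩
  constructor
  · intro h
    refine ⟨tp k V P (cons ∅ Y), ⟨∅, rfl⟩, ?_⟩
    rwa [map_tp]
  · rintro ⟨_, ⟨Z, rfl⟩, h⟩
    rwa [map_tp] at h

theorem exists_raise_of_le {k k' : ℕ} (hk : k ≤ k') {ι : Type} (F : Set (Tp k ι)) :
    ∃ F' : Set (Tp k' ι), ∀ (T : Forest.{u}) (V P : Set T) (Y : ι → Set T),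
      tp k V P Y ∈ F ↔ tp k' V P Y ∈ F' := by
  induction k', hk using Nat.le_induction with
  | base => exact ⟨F, fun _ _ _ _ => Iff.rfl⟩
  | succ n _ ih =>
    obtain ⟨F₁, h₁⟩ := ih
    obtain ⟨F₂, h₂⟩ := exists_raise n F₁
    exact ⟨F₂, fun T V P Y => (h₁ T V P Y).trans (h₂ T V P Y)⟩

/-- The family of sets that represents elements and sets. -/
def singles {T : Type*} {ι κ : Type} (x : ι → T) (Y : κ → Set T) : ι ⊕ κ → Set T :=
  Sum.elim (fun i => {x i}) Y

/-- Monadically definable predicates are decided by a monadic type. -/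
theorem MDef.exists_tp (hΦ : MDef Φ) : ∃ (k : ℕ) (F : Set (Tp k (ι ⊕ κ))),
    ∀ T x Y, Φ T x Y ↔ tp k Set.univ ∅ (singles x Y) ∈ F := by
  unfold MDef at hΦ
  induction hΦ with
  | falsum => exact ⟨0, ∅, fun _ _ _ => by simp⟩
  | @le ι κ i j =>
    refine ⟨0, {s | s.Has (.le (.inl i) (.inl j))}, fun T x Y => ?_⟩
    change _ ↔ ∃ a b, (a ∈ Set.univ ∧ a ∈ ({x i} : Set T)) ∧ (b ∈ Set.univ ∧ b ∈ ({x j} : Set T)) ∧ a ≤ b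
    simp
  | @mem ι κ i l =>
    refine ⟨0, {s | s.Has (.meet (.inl i) (.inr l))}, fun T x Y => ?_⟩
    change _ ↔ ∃ a ∈ Set.univ, a ∈ ({x i} : Set T) ∧ a ∈ Y l
    simp
  | mark h i => exact h.elim
  | imp _ _ h₁ h₂ =>
    obtain ⟨k₁, F₁, h₁⟩ := h₁
    obtain ⟨k₂, F₂, h₂⟩ := h₂
    obtain ⟨G₁, hG₁⟩ := exists_raise_of_le (le_max_left k₁ k₂) F₁
    obtain ⟨G₂, hG₂⟩ := exists_raise_of_le (le_max_right k₁ k₂) F₂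
    refine ⟨max k₁ k₂, {τ | τ ∈ G₁ → τ ∈ G₂}, fun T x Y => ?_⟩
    exact imp_congr ((h₁ T x Y).trans (hG₁ _ _ _ _)) ((h₂ T x Y).trans (hG₂ _ _ _ _))
  | @cons_all ι κ Φ _ h =>
    obtain ⟨k, F, h⟩ := h
    -- `S` recognizes at rank `k` that the added set is a singleton, so a quantifier over elements
    -- becomes a quantifier over sets.
    obtain ⟨S, hS⟩ := exists_raise_of_le.{u} (Nat.zero_le k) (ι := Option (ι ⊕ κ))
      {s | s.Has (.meet none none) ∧ ¬ s.Has (.multi none)}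
    let f : Option ι ⊕ κ → Option (ι ⊕ κ)
      | .inl none => none
      | .inl (some i) => some (.inl i)
      | .inr l => some (.inr l)
    have hf : ∀ (T : Forest.{u}) (a : T) (x : ι → T) (Y : κ → Set T),
        cons {a} (singles x Y) ∘ f = singles (cons a x) Y := by
      intro T a x Y
      funext o
      rcases o with (_ | i) | l <;> rfl
    refine ⟨k + 1, {τ | ∀ σ : Tp k (Option (ι ⊕ κ)),
      Membership.mem (γ := Set (Tp k (Option (ι ⊕ κ)))) τ σ → σ ∈ S → σ.map k f ∈ F},
      fun T x Y => ?_⟩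
    constructor
    · rintro ha _ ⟨Z, rfl⟩ hσ
      obtain ⟨⟨a, -, ha₁, -⟩, hm⟩ := (hS T _ _ _).2 hσ
      have hZ : Z = {a} := by
        refine Set.eq_singleton_iff_unique_mem.2 ⟨ha₁, fun b hb => ?_⟩
        by_contra hne
        exact hm ⟨b, a, ⟨trivial, hb⟩, ⟨trivial, ha₁⟩, hne⟩
      subst hZ
      dsimp only
      rw [map_tp, hf]
      exact (h T _ Y).1 (ha a)
    · intro ha a
      rw [h, ← hf, ← map_tp]
      refine ha _ ⟨{a}, rfl⟩ ((hS T _ _ _).1 ⟨⟨a, trivial, rfl, rfl⟩, ?_⟩)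
      rintro ⟨b, c, ⟨-, hb⟩, ⟨-, hc⟩, hne⟩
      exact hne (hb.trans hc.symm)
  | @cons_allSet ι κ Φ _ _ h =>
    obtain ⟨k, F, h⟩ := h
    let f : ι ⊕ Option κ → Option (ι ⊕ κ)
      | .inl i => some (.inl i)
      | .inr none => none
      | .inr (some l) => some (.inr l)
    have hf : ∀ (T : Forest.{u}) (Z : Set T) (x : ι → T) (Y : κ → Set T),
        cons Z (singles x Y) ∘ f = singles x (cons Z Y) := by
      intro T a x Y
      funext o
      rcases o with i | _ | l <;> rfl
    refine ⟨k + 1, {τ | ∀ σ : Tp k (Option (ι ⊕ κ)),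
      Membership.mem (γ := Set (Tp k (Option (ι ⊕ κ)))) τ σ → σ.map k f ∈ F},
      fun T x Y => ?_⟩
    constructor
    · rintro ha _ ⟨Z, rfl⟩
      dsimp only
      rw [map_tp, hf]
      exact (h T _ _).1 (ha Z)
    · intro ha Z
      rw [h, ← hf, ← map_tp]
      exact ha _ ⟨Z, rfl⟩

end MDef

open Forest

/-! ### Slots -/

/-- The runs of a deterministic automaton are kept in slots such that the slot of a run never
increases. -/
theorem exists_slot_step {Q : Type} [Finite Q] {N : ℕ} (c : Q ≃ Fin N) (g : Q → Q) :
    ∃ d : Q ≃ Fin N, ∀ q, d (g q) ≤ c q := by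
  classical
  have := Fintype.ofFinite Q
  -- Each state in the range of `g` takes the least slot among its preimages. Different states have
  -- different preimages, hence different slots, and the states outside the range fill the slots
  -- left over.
  have hmin : ∀ r ∈ Finset.univ.image g, ∃ q, g q = r ∧ ∀ q', g q' = r → c q ≤ c q' := by
    intro r hr
    obtain ⟨q₀, -, hq₀⟩ := Finset.mem_image.1 hr
    obtain ⟨q, hq, h⟩ := Finset.exists_min_image (Finset.univ.filter fun q => g q = r) c
      ⟨q₀, by simpa using hq₀⟩
    exact ⟨q, by simpa using hq, fun q' hq' => h q' (by simpa using hq')⟩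
  choose! m hm hmin using hmin
  obtain ⟨d, hd⟩ := Finset.exists_equiv_extend_of_card_eq
    (t := (Finset.univ : Finset (Fin N))) (s := Finset.univ.image g) (f := fun r => c (m r))
    (by simpa using Fintype.card_congr c) (by simp) (by
      intro r hr r' hr' h
      rw [← hm r hr, ← hm r' hr', c.injective h])
  refine ⟨d.trans (Equiv.subtypeUnivEquiv fun _ => Finset.mem_univ _), fun q => ?_⟩
  have hq : g q ∈ Finset.univ.image g := Finset.mem_image_of_mem g (Finset.mem_univ q)
  calc ((d (g q) : Finset.univ) : Fin N) = c (m (g q)) := hd _ hq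
    _ ≤ c q := hmin _ hq _ rfl

/-- A step of a slot assignment. -/
noncomputable def slotStep {Q : Type} [Finite Q] {N : ℕ} (c : Q ≃ Fin N) (g : Q → Q) : Q ≃ Fin N :=
  (exists_slot_step c g).choose

theorem slotStep_le {Q : Type} [Finite Q] {N : ℕ} (c : Q ≃ Fin N) (g : Q → Q) (q : Q) :
    slotStep c g (g q) ≤ c q :=
  (exists_slot_step c g).choose_spec q

/-- `Track M x i y j`: the relations `M z` for `x < z ≤ y` lead from `i` to `j`. -/
inductive Track {T : Forest.{u}} {N : ℕ} (M : T → Fin N → Fin N → Prop) (x : T) (i : Fin N) :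
    T → Fin N → Prop
  | refl : Track M x i x i
  | step {y z : T} {j j' : Fin N} : Track M x i y j → y ⋖ z → M z j j' → Track M x i z j'

namespace Track

variable {T : Forest.{u}} {N : ℕ} {M : T → Fin N → Fin N → Prop} {x y z : T} {i j j' : Fin N}

theorem le (h : Track M x i y j) : x ≤ y := by
  induction h with
  | refl => exact le_rfl
  | step _ hyz _ ih => exact ih.trans hyz.lt.le

theorem trans (h : Track M x i y j) (h' : Track M y j z j') : Track M x i z j' := by
  induction h' with
  | refl => exact h
  | step _ hyz hM ih => exact ih.step hyz hM

/-- Parents are unique, so two tracks with the same end pass through the same nodes. -/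
theorem functional (hM : ∀ z i j j', M z i j → M z i j' → j = j') (h : Track M x i y j)
    (h' : Track M x i y j') : j = j' := by
  induction h generalizing j' with
  | refl =>
    cases h' with
    | refl => rfl
    | step h hyz _ => exact (h.le.not_gt hyz.lt).elim
  | step h hyz hj ih =>
    cases h' with
    | refl => exact (h.le.not_gt hyz.lt).elim
    | step h₁ hyz₁ hj₁ =>
      obtain rfl := parent_unique hyz hyz₁
      obtain rfl := ih h₁
      exact hM _ _ _ _ hj hj₁

theorem const (hxy : x ≤ y) (h : ∀ z, x < z → z ≤ y → M z i i) : Track M x i y i := by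
  induction y using lt_wf.induction with
  | _ y ih =>
    rcases hxy.eq_or_lt with rfl | hlt
    · exact refl
    · obtain ⟨p, hxp, hpy⟩ := exists_le_covBy hlt
      exact (ih p hpy.lt hxp fun z hz hzp => h z hz (hzp.trans hpy.lt.le)).step hpy (h y hlt le_rfl)

/-- The track is cut at its first drop: before it the slot is constant, and after it the track
starts from a strictly smaller slot. -/
theorem iff (hM : ∀ z i j, M z i j → j ≤ i) :
    Track M x i y j ↔ x ≤ y ∧ ((i = j ∧ ∀ z, x < z → z ≤ y → M z i i) ∨
      ∃ z, x < z ∧ z ≤ y ∧ (∀ w, x < w → w < z → M w i i) ∧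
        ∃ i', i' < i ∧ M z i i' ∧ Track M z i' y j) := by
  constructor
  · intro h
    refine ⟨h.le, ?_⟩
    induction h with
    | refl => exact .inl ⟨rfl, fun z hz hz' => (hz'.not_gt hz).elim⟩
    | @step y z j j' h hyz hj ih =>
      rcases ih with ⟨rfl, hc⟩ | ⟨w, hxw, hwy, hc, i', hi', hMw, ht⟩
      · have hc' : ∀ w, x < w → w < z → M w i i := fun w hw hwz =>
          hc w hw (le_parent hyz hwz)
        have hxz : x < z := h.le.trans_lt hyz.lt
        rcases (hM _ _ _ hj).eq_or_lt with rfl | hlt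
        · refine .inl ⟨rfl, fun w hw hwz => ?_⟩
          rcases hwz.eq_or_lt with rfl | hwz
          exacts [hj, hc' w hw hwz]
        · exact .inr ⟨z, hxz, le_rfl, hc', j', hlt, hj, refl⟩
      · exact .inr ⟨w, hxw, hwy.trans hyz.lt.le, hc, i', hi', hMw, ht.step hyz hj⟩
  · rintro ⟨hxy, ⟨rfl, h⟩ | ⟨z, hxz, hzy, hc, i', -, hMz, ht⟩⟩
    · exact const hxy h
    · obtain ⟨p, hxp, hpz⟩ := exists_le_covBy hxz
      exact ((const hxp fun w hw hwp => hc w hw (hwp.trans_lt hpz.lt)).step hpz hMz).trans ht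

/-- Induction on the starting slot `i`: being constant up to the first drop is a first-order
condition on the path, and the remaining track falls under the induction hypothesis. -/
theorem fm {κ : Type} {N : ℕ}
    {M : ∀ T : Forest.{u}, (κ → Set T) → T → Fin N → Fin N → Prop}
    (hM : ∀ i j, MDef (fun T (x : Unit → T) Y => M T Y (x ()) i j))
    (hdec : ∀ T Y z i j, M T Y z i j → j ≤ i) (i j : Fin N) {ι : Type} (a b : ι) :
    FM (fun T x Y => Track (M T Y) (x a) i (x b) j) := by
  induction i using WellFoundedLT.induction generalizing ι with
  | _ i ih =>
    refine Definable.congr ?_ fun T x Y => Track.iff (hdec T Y)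
    refine (Definable.le a b).and (((Definable.const _).and (all ((lt _ _).imp
      ((Definable.le _ _).imp ((hM i i).fm none))))).or ?_)
    refine ex ((lt _ _).and ((Definable.le _ _).and ((all ((lt _ _).imp ((lt _ _).imp
      ((hM i i).fm none)))).and (ex_finite fun i' => ?_))))
    by_cases hi : i' < i
    · exact (Definable.const _).and (((hM i i').fm none).and (ih i' hi none (some b)))
    · exact (Definable.const False).congr fun _ _ _ => by simp [hi]

end Track

/-! ### Types of segments -/

theorem MDef.allSet_finite {C ι κ : Type} [Finite C]
    {Φ : ∀ T : Forest.{u}, (ι → T) → (κ → Set T) → (C → Set T) → Prop}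
    (h : MDef (fun T x (Y : κ ⊕ C → Set T) => Φ T x (fun l => Y (.inl l)) (fun c => Y (.inr c)))) :
    MDef (fun T x Y => ∀ R, Φ T x Y R) := by
  induction C using Finite.induction_empty_option generalizing κ with
  | of_equiv e ih =>
    refine (ih (Φ := fun T x Y R => Φ T x Y (fun b => R (e.symm b)))
      (h.reindexSets (Sum.map id e.symm))).congr fun T x Y => ?_
    exact ⟨fun h R => h _, fun h R => by simpa using h (fun a => R (e a))⟩
  | h_empty =>
    refine (h.reindexSets (fun o : κ ⊕ PEmpty => o.elim id PEmpty.elim)).congr fun T x Y => ?_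
    exact ⟨fun h => h _, fun h R => by rwa [Subsingleton.elim R]⟩
  | h_option ih =>
    rename_i α _
    have := ih (κ := Option κ) (Φ := fun T x Y R => Φ T x (fun l => Y (some l)) (cons (Y none) R)) (by
      refine Definable.congr (h.reindexSets (fun o : κ ⊕ Option α => match o with
        | .inl l => Sum.inl (some l)
        | .inr none => .inl none
        | .inr (some c) => .inr c)) fun T x Y => ?_
      rw [iff_iff_eq]
      congr 1
      funext o
      cases o <;> rfl)
    refine (Definable.allSet trivial
      (Φ := fun T x Y Z => ∀ R, Φ T x Y (cons Z R)) this).congr fun T x Y => ?_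
    refine ⟨fun h Z R => h _, fun h R => ?_⟩
    have : R = cons (R none) (fun a => R (some a)) := by
      funext o
      cases o <;> rfl
    rw [this]
    exact h _ _

/-- The type of the nodes above `x` that are not above `y`, with port to `y`. -/
def segType (k : ℕ) {T : Forest.{u}} {l : Type} (Z : l → Set T) (x y : T) : Tp k l :=
  tp k (Set.Ici x \ Set.Ici y) (Set.Iio y) Z

/-- Elements below a common node are comparable, so a node outside `Set.Ici y` lies below an element
of `Set.Ici y` exactly if it lies below `y`. Hence the ports towards `y` and towards `z` agree on
the lower piece. -/
theorem tp_diff_Ici_trans (k : ℕ) {T : Forest.{u}} {l : Type} (Z : l → Set T) {U : Set T} {y z : T}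
    (hU : Set.Ici y ⊆ U) (hyz : y ≤ z) :
    tp k (U \ Set.Ici z) (Set.Iio z) Z =
      (tp k (U \ Set.Ici y) (Set.Iio y) Z).comp k (segType k Z y z) := by
  have key : ∀ v w : T, ¬ y ≤ v → y ≤ w → (v ≤ w ↔ v < y) := fun v w hv hw =>
    ⟨fun h => lt_of_le_not_ge ((le_total_of_le h hw).resolve_right hv) hv, fun h => h.le.trans hw⟩
  have key' : ∀ v : T, ¬ y ≤ v → (v < z ↔ v < y) := fun v hv =>
    ⟨fun h => (key v z hv hyz).1 h.le, fun h => h.trans_le hyz⟩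
  have hV : U \ Set.Ici z = (U \ Set.Ici y) ∪ (Set.Ici y \ Set.Ici z) := by
    ext v
    simp only [Set.mem_union, Set.mem_sdiff, Set.mem_Ici]
    constructor
    · rintro ⟨h₁, h₂⟩
      by_cases h : y ≤ v <;> tauto
    · rintro (⟨h₁, h₂⟩ | ⟨h₁, h₂⟩)
      exacts [⟨h₁, fun h => h₂ (hyz.trans h)⟩, ⟨hU h₁, h₂⟩]
  unfold segType
  rw [hV, tp_union k Z]
  · congr 1
    exact tp_congr k (fun v hv => key' v hv.2) fun _ _ _ => Iff.rfl
  · exact Set.disjoint_left.2 fun v hv hw => hv.2 hw.1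
  · intro v hv w hw
    exact (key v w hv.2 hw.1).trans (key' v hv.2).symm
  · exact fun v hv w hw h => hv.2 (le_trans hw.1 h)

theorem segType_trans (k : ℕ) {T : Forest.{u}} {l : Type} (Z : l → Set T) {x y z : T}
    (hxy : x ≤ y) (hyz : y ≤ z) :
    segType k Z x z = (segType k Z x y).comp k (segType k Z y z) :=
  tp_diff_Ici_trans k Z (Set.Ici_subset_Ici.2 hxy) hyz

theorem tp_diff_Ici (k : ℕ) {T : Forest.{u}} {l : Type} (Z : l → Set T) {U : Set T} {y : T}
    (hU : Set.Ici y ⊆ U) :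
    tp k U (Set.Iio y) Z =
      (tp k (U \ Set.Ici y) (Set.Iio y) Z).comp k (tp k (Set.Ici y) ∅ Z) := by
  conv_lhs => rw [← Set.sdiff_union_of_subset hU]
  rw [tp_union k Z]
  · congr 1
    refine tp_congr k (fun v hv => ?_) fun _ _ _ => Iff.rfl
    exact iff_of_false (fun h : v < y => h.not_ge hv) id
  · exact Set.disjoint_left.2 fun v hv hw => hv.2 hw
  · intro v hv w hw
    exact ⟨fun h => lt_of_le_not_ge ((le_total_of_le h hw).resolve_right hv.2) hv.2,
      fun h => h.le.trans hw⟩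
  · exact fun v hv w hw h => hv.2 (le_trans hw h)

/-! ### Slot assignments along paths -/

section Segment

variable {k : ℕ} {l : Type} [Finite l]

/-- The slot assignments for types. -/
abbrev Slots (k : ℕ) (l : Type) : Type := Tp k l ≃ Fin (Nat.card (Tp k l))

/-- The slot assignment of a child. -/
noncomputable def nextSlots (c : Slots k l) (a : Tp k l) : Slots k l :=
  slotStep c fun q => q.comp k a

open Classical in
/-- The slot assignment of a node. -/
noncomputable def slots {T : Forest.{u}} (Z : l → Set T) : T → Slots k l :=
  lt_wf.fix fun y rec =>
    if h : ∃ p, p ⋖ y then nextSlots (rec h.choose h.choose_spec.lt) (segType k Z h.choose y)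
    else Finite.equivFin _

theorem slots_of_covBy {T : Forest.{u}} (Z : l → Set T) {p y : T} (h : p ⋖ y) :
    (slots Z y : Slots k l) = nextSlots (slots Z p) (segType k Z p y) := by
  have he : ∃ p, p ⋖ y := ⟨p, h⟩
  have hp : he.choose = p := parent_unique he.choose_spec h
  conv_lhs => rw [slots, WellFounded.fix_eq]
  rw [dif_pos he]
  change nextSlots (slots Z he.choose) (segType k Z he.choose y) = _
  rw [hp]

theorem slots_of_not_covBy {T : Forest.{u}} (Z : l → Set T) {y : T} (h : ∀ p, ¬ p ⋖ y) :
    (slots Z y : Slots k l) = Finite.equivFin _ := by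
  rw [slots, WellFounded.fix_eq, dif_neg (by simpa using h)]

/-- The recursion along parents defines the least family of sets closed under its clauses, and
membership in a least closed family is a universal quantification over finitely many sets. -/
theorem slots_eq_iff {T : Forest.{u}} (Z : l → Set T) (z : T) (c : Slots k l) :
    slots Z z = c ↔ ∀ R : Slots k l → Set T,
      (∀ y, (∀ p, ¬ p ⋖ y) → y ∈ R (Finite.equivFin _)) →
      (∀ p y, p ⋖ y → ∀ c a, p ∈ R c → segType k Z p y = a → y ∈ R (nextSlots c a)) → z ∈ R c := by
  constructor
  · rintro rfl R h₀ h₁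
    induction z using lt_wf.induction with
    | _ z ih =>
      by_cases h : ∃ p, p ⋖ z
      · obtain ⟨p, hp⟩ := h
        rw [slots_of_covBy Z hp]
        exact h₁ p z hp _ _ (ih p hp.lt) rfl
      · rw [slots_of_not_covBy Z (by simpa using h)]
        exact h₀ z (by simpa using h)
  · intro h
    refine h (fun c => {z | slots Z z = c}) (fun y hy => slots_of_not_covBy Z hy) ?_
    rintro p y hp c a rfl rfl
    exact slots_of_covBy Z hp

/-- The change of the slots at a node. -/
def SlotMove (k : ℕ) {T : Forest.{u}} (Z : l → Set T) (z : T) (i j : Fin (Nat.card (Tp k l))) :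
    Prop :=
  ∃ p, p ⋖ z ∧ slots Z z (((slots Z p).symm i).comp k (segType k Z p z)) = j

theorem SlotMove.le {T : Forest.{u}} {Z : l → Set T} {z : T} {i j : Fin (Nat.card (Tp k l))}
    (h : SlotMove k Z z i j) : j ≤ i := by
  obtain ⟨p, hp, rfl⟩ := h
  rw [slots_of_covBy Z hp]
  refine (slotStep_le _ _ _).trans ?_
  simp

theorem SlotMove.functional {T : Forest.{u}} {Z : l → Set T} {z : T}
    {i j j' : Fin (Nat.card (Tp k l))} (h : SlotMove k Z z i j) (h' : SlotMove k Z z i j') :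
    j = j' := by
  obtain ⟨p, hp, rfl⟩ := h
  obtain ⟨q, hq, rfl⟩ := h'
  rw [parent_unique hp hq]

/-- The run started at `x` is at `y` in the state `segType k Z x y`, because by `segType_trans`
passing to a child composes with the type of the segment from parent to child. -/
theorem track_segType {T : Forest.{u}} (Z : l → Set T) {x y : T} (hxy : x ≤ y) :
    Track (SlotMove k Z) x (slots Z x (segType k Z x x)) y (slots Z y (segType k Z x y)) := by
  induction y using lt_wf.induction with
  | _ y ih =>
    rcases hxy.eq_or_lt with rfl | hlt
    · exact .refl
    · obtain ⟨p, hxp, hp⟩ := exists_le_covBy hlt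
      refine (ih p hp.lt hxp).step hp ⟨p, hp, ?_⟩
      rw [Equiv.symm_apply_apply, segType_trans k Z hxp hp.lt.le]

variable {κ : Type} {Z : ∀ T : Forest.{u}, (κ → Set T) → l → Set T}

theorem mdef_segType (hZ : ∀ i, MDef (fun T (x : Unit → T) Y => x () ∈ Z T Y i)) {ι : Type}
    (a b : ι) (τ : Tp k l) : MDef (fun T x Y => segType k (Z T Y) (x a) (x b) = τ) :=
  mdef_tp k ((DSet.Ici a).diff (DSet.Ici b)) (DSet.Iio b)
    (Z := fun T _ Y => Z T Y) (fun i => (hZ i).reindex fun _ => none) τ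

theorem mdef_slots (hZ : ∀ i, MDef (fun T (x : Unit → T) Y => x () ∈ Z T Y i)) {ι : Type}
    (a : ι) (c : Slots k l) : MDef (fun T x Y => slots (Z T Y) (x a) = c) := by
  refine Definable.congr (MDef.allSet_finite ?_) fun T x Y => slots_eq_iff (Z T Y) (x a) c
  refine (all ((all (covBy _ _).not).imp (mem _ _))).imp (.imp ?_ (mem _ _))
  refine all (all ((covBy _ _).imp (all_finite fun c => all_finite fun b =>
    (mem _ _).imp (.imp ?_ (mem _ _)))))
  exact (mdef_segType hZ (some none) none b).reindexSets Sum.inl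

theorem mdef_slotMove (hZ : ∀ i, MDef (fun T (x : Unit → T) Y => x () ∈ Z T Y i)) {ι : Type}
    (a : ι) (i j : Fin (Nat.card (Tp k l))) :
    MDef (fun T x Y => SlotMove k (Z T Y) (x a) i j) := by
  refine ex ((covBy _ _).and ?_)
  refine (ex_finite fun c : Slots k l => ex_finite fun d : Slots k l => ex_finite fun b : Tp k l =>
    (mdef_slots hZ none c).and ((mdef_slots hZ (some a) d).and ((mdef_segType hZ none (some a) b).and
      (const (d ((c.symm i).comp k b) = j))))).congr fun T x Y => ?_
  exact ⟨fun h => ⟨_, _, _, rfl, rfl, rfl, h⟩, by rintro ⟨_, _, _, rfl, rfl, rfl, h⟩; exact h⟩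

/-- Types of segments are first-order definable from unary monadic predicates. -/
theorem fm_segType (hZ : ∀ i, MDef (fun T (x : Unit → T) Y => x () ∈ Z T Y i)) {ι : Type}
    (a b : ι) (τ : Tp k l) :
    FM (fun T x Y => x a ≤ x b ∧ segType k (Z T Y) (x a) (x b) = τ) := by
  -- `c` and `d` are the slot assignments at the two ends, and `e`, the type of the empty segment,
  -- is the initial state.
  refine Definable.congr (ex_finite fun c : Slots k l => ex_finite fun d : Slots k l =>
    ex_finite fun e : Tp k l => ((mdef_slots hZ () c).fm a).and (((mdef_slots hZ () d).fm b).and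
      (((mdef_segType hZ () () e).fm a).and
        (Track.fm (M := fun T Y z i j => SlotMove k (Z T Y) z i j)
          (fun i j => mdef_slotMove hZ () i j) (fun _ _ _ _ _ h => h.le) (c e) (d τ) a b))))
    fun T x Y => ?_
  constructor
  · rintro ⟨hab, rfl⟩
    exact ⟨_, _, _, rfl, rfl, rfl, track_segType _ hab⟩
  · rintro ⟨_, _, _, rfl, rfl, rfl, h⟩
    refine ⟨h.le, ?_⟩
    -- The track of the true segment type has the same start, so it ends in the same slot; the
    -- assignment at the end node is injective.
    have := h.functional (M := SlotMove k (Z T Y)) (fun _ _ _ _ => SlotMove.functional)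
      (track_segType (Z T Y) h.le)
    exact ((slots _ _).injective this).symm

end Segment

/-! ### Binary predicates -/

/-- Two nodes are siblings if they are different and have the same nodes below them. -/
def Sib {T : Forest.{u}} (c d : T) : Prop := c ≠ d ∧ ∀ z, z < c ↔ z < d

namespace Sib

variable {T : Forest.{u}} {c d e : T}

theorem symm (h : Sib c d) : Sib d c := ⟨h.1.symm, fun z => (h.2 z).symm⟩

theorem trans (h : Sib c d) (h' : Sib c e) (hne : d ≠ e) : Sib d e :=
  ⟨hne, fun z => (h.2 z).symm.trans (h'.2 z)⟩

theorem Iio_eq (h : Sib c d) : Set.Iio c = Set.Iio d := Set.ext h.2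

theorem not_le (h : Sib c d) {w : T} (hc : c ≤ w) : ¬ d ≤ w := by
  intro hd
  rcases le_total_of_le hc hd with hle | hle
  · exact lt_irrefl c ((h.2 c).2 (lt_of_le_of_ne hle h.1))
  · exact lt_irrefl d ((h.2 d).1 (lt_of_le_of_ne hle h.1.symm))

/-- Take `c` minimal among the nodes below `x` that are not below `y`, and `d` symmetrically. By
minimality, whatever is strictly below one of them is below both `x` and `y`, hence strictly below
the other. -/
theorem exists_le {x y : T} (hxy : ¬ x ≤ y) (hyx : ¬ y ≤ x) :
    ∃ c d, Sib c d ∧ c ≤ x ∧ d ≤ y := by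
  obtain ⟨c, hcx, hcy, hc⟩ := exists_minimal_le (p := fun c => ¬ c ≤ y) hxy
  obtain ⟨d, hdy, hdx, hd⟩ := exists_minimal_le (p := fun c => ¬ c ≤ x) hyx
  refine ⟨c, d, ⟨?_, fun z => ⟨fun hz => ?_, fun hz => ?_⟩⟩, hcx, hdy⟩
  · rintro rfl
    exact hcy hdy
  · have hzy : z ≤ y := not_not.1 (hc z hz)
    refine lt_of_le_not_ge ((le_total_of_le hzy hdy).resolve_right ?_) ?_ <;>
      exact fun h => hdx (h.trans (hz.le.trans hcx))
  · have hzx : z ≤ x := not_not.1 (hd z hz)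
    refine lt_of_le_not_ge ((le_total_of_le hzx hcx).resolve_right ?_) ?_ <;>
      exact fun h => hcy (h.trans (hz.le.trans hdy))

end Sib

/-- The type of the nodes that are neither above `c` nor above `d`. -/
def restType (k : ℕ) {T : Forest.{u}} {l : Type} (Z : l → Set T) (c d : T) : Tp k l :=
  tp k ((Set.univ \ Set.Ici c) \ Set.Ici d) (Set.Iio c) Z

/-- Siblings have the same strict predecessors, so both cones are attached to the same port. -/
theorem tp_univ_of_sib (k : ℕ) {T : Forest.{u}} {l : Type} (Z : l → Set T) {c d : T} (h : Sib c d) :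
    tp k Set.univ (Set.Iio c) Z =
      ((restType k Z c d).comp k (tp k (Set.Ici d) ∅ Z)).comp k (tp k (Set.Ici c) ∅ Z) := by
  rw [tp_diff_Ici k Z (Set.subset_univ _), restType, h.Iio_eq, tp_diff_Ici k Z (U := _ \ _)]
  exact fun w hw => ⟨trivial, h.symm.not_le hw⟩

/-- The type of the rest depends only on the type of what is above the second sibling. -/
theorem restType_congr (k : ℕ) {T : Forest.{u}} {l : Type} (Z : l → Set T) {c d e : T}
    (hd : Sib c d) (he : Sib c e) (h : tp k (Set.Ici d) ∅ Z = tp k (Set.Ici e) ∅ Z) :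
    restType k Z c d = restType k Z c e := by
  by_cases hde : d = e
  · rw [hde]
  have hs : Sib d e := hd.trans he hde
  -- Both rests extend the remainder without all three cones: one by the cone of `e`, the other by
  -- the cone of `d`, at the same port and with the same type.
  have h₁ := tp_diff_Ici k Z (U := (Set.univ \ Set.Ici c) \ Set.Ici d) (y := e)
    fun w hw => ⟨⟨trivial, he.symm.not_le hw⟩, hs.symm.not_le hw⟩
  have h₂ := tp_diff_Ici k Z (U := (Set.univ \ Set.Ici c) \ Set.Ici e) (y := d)
    fun w hw => ⟨⟨trivial, hd.symm.not_le hw⟩, hs.not_le hw⟩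
  rw [← he.Iio_eq] at h₁
  rw [← hd.Iio_eq] at h₂
  rw [restType, restType, h₁, h₂, h, sdiff_right_comm]

section

variable {so : Prop} {mk : ∀ κ : Type, Pred.{u} Unit κ → Prop} {ι κ : Type}

theorem Definable.sib (i j : ι) : Definable so mk (fun _ x (_ : κ → Set _) => Sib (x i) (x j)) :=
  (eq i j).not.and (all ((lt _ _).iff (lt _ _)))

end

section

variable {k : ℕ} {κ l : Type} [Finite l] {Z : ∀ T : Forest.{u}, (κ → Set T) → l → Set T}

theorem mdef_tp_Ici (hZ : ∀ i, MDef (fun T (x : Unit → T) Y => x () ∈ Z T Y i)) {ι : Type}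
    (a : ι) (τ : Tp k l) : MDef (fun T x Y => tp k (Set.Ici (x a)) ∅ (Z T Y) = τ) :=
  mdef_tp k (DSet.Ici a) DSet.empty
    (Z := fun T _ Y => Z T Y) (fun i => (hZ i).reindex fun _ => none) τ

theorem mdef_restType (hZ : ∀ i, MDef (fun T (x : Unit → T) Y => x () ∈ Z T Y i)) {ι : Type}
    (a b : ι) (τ : Tp k l) : MDef (fun T x Y => restType k (Z T Y) (x a) (x b) = τ) :=
  mdef_tp k ((DSet.univ.diff (DSet.Ici a)).diff (DSet.Ici b)) (DSet.Iio a)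
    (Z := fun T _ Y => Z T Y) (fun i => (hZ i).reindex fun _ => none) τ

/-- By `restType_congr`, the first sibling can carry as a mark the rest type that belongs to each
type `τ` of a second sibling; the second sibling carries its own `τ`. -/
theorem fm_restType (hZ : ∀ i, MDef (fun T (x : Unit → T) Y => x () ∈ Z T Y i)) {ι : Type}
    (a b : ι) (ρ : Tp k l) :
    FM (fun T x Y => Sib (x a) (x b) ∧ restType k (Z T Y) (x a) (x b) = ρ) := by
  refine ((sib a b).and (ex_finite fun τ : Tp k l => ((mdef_tp_Ici hZ () τ).fm b).and
    (MDef.fm (μ := fun T x Y => ∃ d, Sib (x ()) d ∧ tp k (Set.Ici d) ∅ (Z T Y) = τ ∧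
      restType k (Z T Y) (x ()) d = ρ) (ex ((sib _ _).and
        ((mdef_tp_Ici hZ none τ).and (mdef_restType hZ (some ()) none ρ)))) a))).congr
    fun T x Y => and_congr_right fun h => ?_
  constructor
  · rintro rfl
    exact ⟨_, rfl, x b, h, rfl, rfl⟩
  · rintro ⟨_, rfl, d, hd, hτ, rfl⟩
    exact restType_congr k _ h hd hτ.symm

end

/-! ### Comparable and incomparable pairs -/

section

/-- The sets in `Y` and two further sets. -/
def pairs {T : Type*} {κ : Type} (A B : Set T) (Y : κ → Set T) : Bool ⊕ κ → Set T :=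
  Sum.elim (fun b => cond b B A) Y

theorem singles_eq_pairs {T : Type*} {κ : Type} (x : Bool → T) (Y : κ → Set T) :
    singles x Y = pairs {x false} {x true} Y := by
  funext o
  rcases o with (_ | _) | _ <;> rfl

theorem tp_pairs_congr (k : ℕ) {κ : Type} {T : Forest.{u}} {V P A A' B B' : Set T} {Y : κ → Set T}
    (hA : ∀ x ∈ V, x ∈ A ↔ x ∈ A') (hB : ∀ x ∈ V, x ∈ B ↔ x ∈ B') :
    tp k V P (pairs A B Y) = tp k V P (pairs A' B' Y) := by
  refine tp_congr k (fun _ _ => Iff.rfl) ?_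
  rintro ((_ | _) | i) x hx
  exacts [hA x hx, hB x hx, Iff.rfl]

theorem dset_pairs {ι κ : Type} {A B : ∀ T : Forest.{u}, (ι → T) → (κ → Set T) → Set T}
    (hA : DSet A) (hB : DSet B) (o : Bool ⊕ κ) :
    DSet (fun T x Y => pairs (A T x Y) (B T x Y) Y o) := by
  rcases o with (_ | _) | l
  exacts [hA, hB, DSet.var l]

theorem mdef_empty_pairs {κ : Type} (o : Bool ⊕ κ) :
    MDef (fun T (x : Unit → T) Y => x () ∈ pairs ∅ ∅ Y o) :=
  (dset_pairs (DSet.empty (ι := Unit)) DSet.empty o).mem ()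

variable {κ : Type} {Φ : Pred.{u} Bool κ}

/-- The cuts are at the second node and at the child `c` of the first node towards it. The first
node is the parent of `c`, so the type of the bottom piece is unary in `c`; the top piece is unary
in the second node; the middle piece contains neither argument, and `fm_segType` applies. -/
theorem fm_lt [Finite κ] (hΦ : MDef Φ) : FM (fun T x Y => x false < x true ∧ Φ T x Y) := by
  obtain ⟨k, F, hF⟩ := hΦ.exists_tp
  have h₁ : ∀ α, MDef (fun (T : Forest.{u}) (x : Unit → T) (Y : κ → Set T) =>
      tp k (Set.univ \ Set.Ici (x ())) (Set.Iio (x ())) (pairs {p | p ⋖ x ()} ∅ Y) = α) := fun α =>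
    mdef_tp k (DSet.univ.diff (DSet.Ici ())) (DSet.Iio ())
      (dset_pairs (show DSet (fun T (x : Unit → T) (_ : κ → Set T) => {p | p ⋖ x ()}) from
        covBy none (some ())) DSet.empty) α
  have h₃ : ∀ γ, MDef (fun (T : Forest.{u}) (x : Unit → T) (Y : κ → Set T) =>
      tp k (Set.Ici (x ())) ∅ (pairs ∅ {x ()} Y) = γ) := fun γ =>
    mdef_tp k (DSet.Ici ()) DSet.empty (dset_pairs DSet.empty (DSet.singleton ())) γ
  refine (ex (Φ := fun T x c Y => x false ⋖ c ∧ ∃ α β γ : Tp k (Bool ⊕ κ),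
    tp k (Set.univ \ Set.Ici c) (Set.Iio c) (pairs {p | p ⋖ c} ∅ Y) = α ∧
    (c ≤ x true ∧ segType k (pairs ∅ ∅ Y) c (x true) = β) ∧
    tp k (Set.Ici (x true)) ∅ (pairs ∅ {x true} Y) = γ ∧ ((α.comp k β).comp k γ).forget k ∈ F)
    ((covBy _ _).and (ex_finite fun α => ex_finite fun β => ex_finite fun γ =>
      ((h₁ α).fm none).and ((fm_segType mdef_empty_pairs none (some true) β).and
        (((h₃ γ).fm (some true)).and (Definable.const _)))))).congr fun T x Y => ?_
  have key : ∀ c, x false ⋖ c → c ≤ x true →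
      tp k Set.univ ∅ (singles x Y) = (((tp k (Set.univ \ Set.Ici c) (Set.Iio c)
        (pairs {p | p ⋖ c} ∅ Y)).comp k (segType k (pairs ∅ ∅ Y) c (x true))).comp k
          (tp k (Set.Ici (x true)) ∅ (pairs ∅ {x true} Y))).forget k := by
    intro c hxc hcy
    rw [singles_eq_pairs, ← forget_tp k _ (Set.Iio (x true)),
      tp_diff_Ici k _ (Set.subset_univ _), tp_diff_Ici_trans k _ (Set.subset_univ _) hcy]
    refine congrArg (Tp.forget k) (congrArg₂ (Tp.comp k) (congrArg₂ (Tp.comp k) ?_ ?_) ?_)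
    · refine tp_pairs_congr k (fun v _ => ⟨?_, fun h => parent_unique h hxc⟩) fun v hv => ?_
      · rintro rfl
        exact hxc
      · refine iff_of_false ?_ id
        rintro rfl
        exact hv.2 hcy
    · refine tp_pairs_congr k (fun v hv => iff_of_false ?_ id) fun v hv => iff_of_false ?_ id
      · rintro rfl
        exact hxc.lt.not_ge hv.1
      · rintro rfl
        exact hv.2 le_rfl
    · refine tp_pairs_congr k (fun v hv => iff_of_false ?_ id) fun v hv => Iff.rfl
      rintro rfl
      exact (hxc.lt.trans_le hcy).not_ge hv
  rw [hF]
  constructor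
  · rintro ⟨hlt, h⟩
    obtain ⟨c, hxc, hcy⟩ := exists_covBy_le hlt
    rw [key c hxc hcy] at h
    exact ⟨c, hxc, _, _, _, rfl, ⟨hcy, rfl⟩, rfl, h⟩
  · rintro ⟨c, hxc, _, _, _, rfl, ⟨hcy, rfl⟩, rfl, h⟩
    rw [key c hxc hcy]
    exact ⟨hxc.lt.trans_le hcy, h⟩

theorem fm_eq (hΦ : MDef Φ) : FM (fun T x Y => x false = x true ∧ Φ T x Y) := by
  refine ((eq _ _).and (MDef.fm (hΦ.reindex fun _ => ()) false)).congr fun T x Y =>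
    and_congr_right fun h => ?_
  have : x = fun _ => x false := by
    funext b
    cases b
    exacts [rfl, h.symm]
  rw [← this]

theorem fm_le [Finite κ] (hΦ : MDef Φ) : FM (fun T x Y => x false ≤ x true ∧ Φ T x Y) :=
  ((fm_eq hΦ).or (fm_lt hΦ)).congr fun T x Y => by rw [le_iff_eq_or_lt, or_and_right]

/-- The cuts are at siblings `c` and `d` below the two nodes. The type of a cone with its argument
is a predicate of a comparable pair, covered by `fm_le`, and the rest contains neither argument, so
`fm_restType` applies. -/
theorem fm_incomparable [Finite κ] (hΦ : MDef Φ) :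
    FM (fun T x Y => (¬ x false ≤ x true ∧ ¬ x true ≤ x false) ∧ Φ T x Y) := by
  obtain ⟨k, F, hF⟩ := hΦ.exists_tp
  have h₁ : ∀ α, FM (fun (T : Forest.{u}) (x : Bool → T) (Y : κ → Set T) => x false ≤ x true ∧
      tp k (Set.Ici (x false)) ∅ (pairs {x true} ∅ Y) = α) := fun α => fm_le <|
    mdef_tp k (DSet.Ici _) DSet.empty (dset_pairs (DSet.singleton _) DSet.empty) α
  have h₂ : ∀ α, FM (fun (T : Forest.{u}) (x : Bool → T) (Y : κ → Set T) => x false ≤ x true ∧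
      tp k (Set.Ici (x false)) ∅ (pairs ∅ {x true} Y) = α) := fun α => fm_le <|
    mdef_tp k (DSet.Ici _) DSet.empty (dset_pairs DSet.empty (DSet.singleton _)) α
  refine (((le _ _).not.and (le _ _).not).and (ex (Φ := fun T x c Y =>
    ∃ d, ∃ α β γ : Tp k (Bool ⊕ κ),
      (c ≤ x false ∧ tp k (Set.Ici c) ∅ (pairs {x false} ∅ Y) = α) ∧
      (d ≤ x true ∧ tp k (Set.Ici d) ∅ (pairs ∅ {x true} Y) = β) ∧
      (Sib c d ∧ restType k (pairs ∅ ∅ Y) c d = γ) ∧ ((γ.comp k β).comp k α).forget k ∈ F)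
    (ex (ex_finite fun α => ex_finite fun β => ex_finite fun γ =>
      ((h₁ α).reindex (fun b => cond b (some (some false)) (some none))).and
      (((h₂ β).reindex (fun b => cond b (some (some true)) none)).and
      ((fm_restType (l := Bool ⊕ κ) mdef_empty_pairs (some none) none γ).and (Definable.const _))))))).congr
      fun T x Y => and_congr_right fun hxy => ?_
  have key : ∀ c d, c ≤ x false → d ≤ x true → Sib c d →
      tp k Set.univ ∅ (singles x Y) = (((restType k (pairs ∅ ∅ Y) c d).comp k
        (tp k (Set.Ici d) ∅ (pairs ∅ {x true} Y))).comp k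
          (tp k (Set.Ici c) ∅ (pairs {x false} ∅ Y))).forget k := by
    intro c d hc hd hs
    rw [singles_eq_pairs, ← forget_tp k _ (Set.Iio c), tp_univ_of_sib k _ hs]
    refine congrArg (Tp.forget k) (congrArg₂ (Tp.comp k) (congrArg₂ (Tp.comp k) ?_ ?_) ?_)
    · refine tp_pairs_congr k (fun v hv => iff_of_false ?_ id) fun v hv => iff_of_false ?_ id
      · rintro rfl
        exact hv.1.2 hc
      · rintro rfl
        exact hv.2 hd
    · refine tp_pairs_congr k (fun v hv => iff_of_false ?_ id) fun v hv => Iff.rfl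
      rintro rfl
      exact hs.not_le hc hv
    · refine tp_pairs_congr k (fun v hv => Iff.rfl) fun v hv => iff_of_false ?_ id
      rintro rfl
      exact hs.symm.not_le hd hv
  rw [hF]
  constructor
  · intro h
    obtain ⟨c, d, hs, hc, hd⟩ := Sib.exists_le hxy.1 hxy.2
    rw [key c d hc hd hs] at h
    exact ⟨c, d, _, _, _, ⟨hc, rfl⟩, ⟨hd, rfl⟩, ⟨hs, rfl⟩, h⟩
  · rintro ⟨c, d, _, _, _, ⟨hc, rfl⟩, ⟨hd, rfl⟩, ⟨hs, rfl⟩, h⟩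
    rwa [key c d hc hd hs]

/-- Binary monadic predicates are first-order definable from unary monadic predicates. -/
theorem fm_binary [Finite κ] (hΦ : MDef Φ) : FM Φ := by
  refine ((fm_le hΦ).or (((fm_le (hΦ.reindex Bool.not)).reindex Bool.not).or
    (fm_incomparable hΦ))).congr fun T x Y => ?_
  have : (fun b => x !!b) = x := by simp
  simp only [Bool.not_false, Bool.not_true, this]
  tauto

end

/-! ### Predicates of arbitrary arity -/

/-- Relativization of first-order definable predicates to definable subforests. -/
theorem FM.relativize {κ : Type} [Finite κ] {V : ∀ T : Forest.{u}, T → Set T}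
    (hV : DSet (fun T (x : Unit → T) (_ : κ → Set T) => V T (x ()))) {ι κ' : Type}
    {Φ : Pred.{u} ι κ'} (hΦ : FM Φ) :
    ∀ [Finite κ'] {G : ∀ T : Forest.{u}, T → (κ → Set T) → κ' → Set T}
      (_hG : ∀ l, DSet (fun T (x : Unit → T) Y => G T (x ()) Y l)),
      ∃ Ψ : Pred.{u} (Option ι) κ, FM Ψ ∧
        ∀ (T : Forest.{u}) (c : T) (x : ι → T.sub (V T c)) (Y : κ → Set T),
          Ψ T (cons c fun i => (x i).1) Y ↔
            Φ (T.sub (V T c)) x (fun l => {a : T.sub (V T c) | a.1 ∈ G T c Y l}) := by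
  have hmem : FM (fun T (x : Bool → T) (_ : κ → Set T) => x true ∈ V T (x false)) :=
    fm_binary ((hV.reindex fun _ => false).mem true)
  unfold FM at hΦ
  induction hΦ with
  | falsum => exact fun _ => ⟨_, falsum, fun _ _ _ _ => Iff.rfl⟩
  | le i j => exact fun _ => ⟨_, Definable.le (some i) (some j), fun _ _ _ _ => Iff.rfl⟩
  | mem i l =>
    intro _ G hG
    exact ⟨_, (fm_binary (((hG l).reindex fun _ => false).mem true)).reindex
      (fun b => cond b (some i) none), fun _ _ _ _ => Iff.rfl⟩
  | @mark ι κ' μ h i =>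
    intro _ G hG
    obtain ⟨k, F, hF⟩ := h.exists_tp
    -- A unary mark of the subforest is decided by a relative type, so it becomes a binary monadic
    -- predicate of the cut node and the element, to which `fm_binary` applies.
    have hτ : ∀ τ, MDef (fun (T : Forest.{u}) (x : Bool → T) (Y : κ → Set T) =>
        tp k (V T (x false)) ∅ (singles (fun _ : Unit => x true) (G T (x false) Y)) = τ) :=
      fun τ => mdef_tp k (hV.reindex fun _ => false) DSet.empty (by
        rintro (i | l)
        exacts [DSet.singleton true, (hG l).reindex fun _ => false]) τ
    refine ⟨_, (fm_binary (ex_finite fun τ => (hτ τ).and (Definable.const (τ ∈ F)))).reindex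
      (fun b => cond b (some i) none), fun T c x Y => ?_⟩
    refine Iff.trans ?_ (hF _ _ _).symm
    simp only [cond_false, cond_true, cons_none, cons_some, exists_eq_left']
    rw [iff_iff_eq, ← tp_sub]
    refine congrArg (· ∈ F) (tp_congr k (fun _ _ => Iff.rfl) ?_)
    rintro (_ | l) a -
    · exact Subtype.ext_iff.symm
    · exact Iff.rfl
  | imp _ _ h₁ h₂ =>
    intro _ G hG
    obtain ⟨Ψ₁, hΨ₁, h₁⟩ := h₁ hG
    obtain ⟨Ψ₂, hΨ₂, h₂⟩ := h₂ hG
    exact ⟨_, hΨ₁.imp hΨ₂, fun T c x Y => imp_congr (h₁ T c x Y) (h₂ T c x Y)⟩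
  | @cons_all ι κ' Φ _ h =>
    intro _ G hG
    obtain ⟨Ψ, hΨ, h⟩ := h hG
    -- Exchanges the freshly bound element with the cut node, which `Ψ` expects first.
    let f : Option (Option ι) → Option (Option ι)
      | none => some none
      | some none => none
      | some (some i) => some (some i)
    refine ⟨fun T z Y => ∀ a, a ∈ V T (z none) →
        Ψ T (cons (z none) (cons a fun i => z (some i))) Y,
      all ((hmem.reindex (fun b => cond b none (some none))).imp
        ((hΨ.reindex f).congr fun T x Y => ?_)), fun T c x Y => ?_⟩
    · rw [iff_iff_eq]
      congr 1
      funext o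
      rcases o with _ | _ | i <;> rfl
    · have hx : ∀ a : T.sub (V T c), (cons a.1 fun i => (x i).1) = fun o => (cons a x o).1 := by
        intro a
        funext o
        cases o <;> rfl
      constructor
      · intro ha a
        rw [← h, ← hx]
        exact ha a.1 a.2
      · intro ha a haV
        exact (congrArg (fun z => Ψ T (cons c z) Y) (hx ⟨a, haV⟩)).mpr
          ((h T c (cons ⟨a, haV⟩ x) Y).2 (ha ⟨a, haV⟩))
  | cons_allSet hso _ _ => exact hso.elim

/-- The singletons of those elements whose index lies in `I`. -/
def partSingles {T : Type*} {ι κ : Type} {I : Set ι} (x : I → T) (Y : κ → Set T) : ι ⊕ κ → Set T :=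
  Sum.elim (fun i => {a | ∃ h : i ∈ I, a = x ⟨i, h⟩}) Y

theorem mdef_tp_partSingles (k : ℕ) {ι κ : Type} [Finite ι] [Finite κ] {I : Set ι}
    (τ : Tp k (ι ⊕ κ)) :
    MDef (fun T (x : I → T) (Y : Option κ → Set T) =>
      tp k Set.univ (Y none) (partSingles x fun l => Y (some l)) = τ) := by
  refine mdef_tp k DSet.univ (DSet.var none) ?_ τ
  rintro (i | l)
  · by_cases h : i ∈ I
    · refine Definable.congr (DSet.singleton (⟨i, h⟩ : I)) fun T x Y => ?_
      exact ⟨fun ⟨_, h⟩ => h, fun h' => ⟨h, h'⟩⟩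
    · exact Definable.congr falsum fun T x Y => ⟨fun ⟨h', _⟩ => h h', False.elim⟩
  · exact DSet.var (some l)

/-- Inside the piece the type only involves the arguments indexed by `I`, the others having empty
trace, so `hI` applies in the subforest. The additional set parameter `none` stands for the port
until relativization replaces it by `P T c`. -/
theorem fm_tp_part (k : ℕ) {ι κ : Type} [Finite ι] [Finite κ] {I : Set ι}
    (hI : ∀ {Φ : Pred.{u} I (Option κ)}, MDef Φ → FM Φ) {V P : ∀ T : Forest.{u}, T → Set T}
    (hV : DSet (fun T (x : Unit → T) (_ : κ → Set T) => V T (x ())))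
    (hP : DSet (fun T (x : Unit → T) (_ : κ → Set T) => P T (x ()))) (τ : Tp k (ι ⊕ κ)) :
    ∃ Ψ : Pred.{u} (Option ι) κ, FM Ψ ∧ ∀ (T : Forest.{u}) (c : T) (x : ι → T) (Y : κ → Set T),
      (∀ i, x i ∈ V T c ↔ i ∈ I) →
        (Ψ T (cons c x) Y ↔ tp k (V T c) (P T c) (singles x Y) = τ) := by
  obtain ⟨Ψ, hΨ, h⟩ := FM.relativize hV (hI (mdef_tp_partSingles k τ))
    (G := fun T c Y => cons (P T c) Y) (by
      rintro (_ | l)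
      exacts [hP, DSet.var l])
  refine ⟨_, hΨ.reindex (Option.map Subtype.val), fun T c x Y hx => ?_⟩
  have := h T c (fun i => ⟨x i, (hx i).2 i.2⟩) Y
  rw [show (fun o => cons c x (Option.map Subtype.val o)) = cons c fun i : I => x i from
    cons_comp_map c x _, this, iff_iff_eq]
  refine congrArg (· = τ) (Eq.trans (tp_congr k (fun _ _ => Iff.rfl) ?_)
    (tp_sub k (V T c) (P T c) (singles x Y)))
  rintro (i | l) a -
  · constructor
    · rintro ⟨_, rfl⟩
      rfl
    · intro ha
      have ha : a.1 = x i := ha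
      exact ⟨(hx i).1 (ha ▸ a.2), Subtype.ext ha⟩
  · rfl

theorem tp_univ_split (k : ℕ) {T : Forest.{u}} {l : Type} (Z : l → Set T) (c : T) :
    tp k Set.univ ∅ Z = ((tp k (Set.univ \ Set.Ici c) (Set.Iio c) Z).comp k
      (tp k (Set.Ici c) ∅ Z)).forget k := by
  rw [← forget_tp k _ (Set.Iio c), tp_diff_Ici k Z (Set.subset_univ _)]

/-- The cone of `c` and its complement each contain one part of the tuple; their types are definable
by the hypotheses on `I` and `Iᶜ`, and they compose to the type that decides `Φ`. -/
theorem fm_split {ι κ : Type} [Finite ι] [Finite κ] {Φ : Pred.{u} ι κ} (hΦ : MDef Φ) {I : Set ι}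
    (hI : ∀ {Φ : Pred.{u} I (Option κ)}, MDef Φ → FM Φ)
    (hI' : ∀ {Φ : Pred.{u} (Iᶜ : Set ι) (Option κ)}, MDef Φ → FM Φ) :
    FM (fun T x Y => ∃ c, (∀ i, c ≤ x i ↔ i ∈ I) ∧ Φ T x Y) := by
  obtain ⟨k, F, hF⟩ := hΦ.exists_tp
  choose Ψ hΨ h using fm_tp_part.{u} k (κ := κ) hI (V := fun T c => Set.Ici c)
    (P := fun _ _ => ∅) (DSet.Ici ()) DSet.empty
  choose Ψ' hΨ' h' using fm_tp_part.{u} k (κ := κ) hI' (V := fun T c => Set.univ \ Set.Ici c)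
    (P := fun T c => Set.Iio c) (DSet.univ.diff (DSet.Ici ())) (DSet.Iio ())
  have hcons : ∀ (T : Forest.{u}) (x : Option ι → T), cons (x none) (fun i => x (some i)) = x := by
    intro T x
    funext o
    cases o <;> rfl
  refine Definable.congr (ex (Φ := fun T x c Y => (∀ i, c ≤ x i ↔ i ∈ I) ∧ ∃ α β : Tp k (ι ⊕ κ),
    Ψ' α T (cons c x) Y ∧ Ψ β T (cons c x) Y ∧ (α.comp k β).forget k ∈ F)
    ((all_finite fun i => (Definable.le _ _).iff (Definable.const _)).and
      (ex_finite fun α => ex_finite fun β => ?_))) fun T x Y =>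
    exists_congr fun c => and_congr_right fun hc => ?_
  · simp only [hcons]
    exact (hΨ' α).and ((hΨ β).and (Definable.const _))
  · have hc' : ∀ i, x i ∈ Set.univ \ Set.Ici c ↔ i ∈ Iᶜ := fun i => by simp [← hc]
    simp only [fun τ => h τ T c x Y hc, fun τ => h' τ T c x Y hc', exists_and_left, exists_eq_left',
      hF, ← tp_univ_split]

/-- Monadic predicates are first-order definable from unary monadic predicates. -/
theorem fm_of_mdef {ι κ : Type} [Finite ι] [Nonempty ι] [Finite κ] {Φ : Pred.{u} ι κ}
    (hΦ : MDef Φ) : FM Φ := by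
  induction hn : Nat.card ι using Nat.strong_induction_on generalizing ι κ with
  | _ n ih =>
    subst hn
    obtain ⟨i₀⟩ := ‹Nonempty ι›
    have hpart : ∀ I : Set ι, I.Nonempty → Iᶜ.Nonempty →
        ∀ {Φ : Pred.{u} I (Option κ)}, MDef Φ → FM Φ := by
      rintro I ⟨i, hi⟩ ⟨j, hj⟩ Φ hΦ
      have : Nonempty I := ⟨⟨i, hi⟩⟩
      exact ih _ (Finite.card_subtype_lt (x := j) hj) hΦ rfl
    refine (((all_finite fun i => Definable.eq i i₀).and
      (MDef.fm (hΦ.reindex fun _ => ()) i₀)).or (ex_finite (C := Set ι)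
      (Φ := fun I T x Y => (I.Nonempty ∧ Iᶜ.Nonempty) ∧ ∃ c, (∀ i, c ≤ x i ↔ i ∈ I) ∧ Φ T x Y)
      fun I => ?_)).congr fun T x Y => ?_
    · by_cases hI : I.Nonempty ∧ Iᶜ.Nonempty
      · exact (Definable.const _).and (fm_split hΦ (hpart I hI.1 hI.2)
          (hpart Iᶜ hI.2 ((compl_compl I).symm ▸ hI.1)))
      · exact falsum.congr fun _ _ _ => by simp [hI]
    · constructor
      · intro h
        by_cases heq : ∀ i, x i = x i₀
        · refine .inl ⟨heq, ?_⟩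
          rwa [← show x = fun _ => x i₀ from funext heq]
        · push Not at heq
          obtain ⟨i, hi⟩ := heq
          refine .inr ?_
          -- Of two distinct elements, one is not below the other, so its cone contains the first
          -- and misses the second. Both parts of the tuple are then nonempty, hence shorter.
          by_cases hle : x i ≤ x i₀
          · exact ⟨{j | x i₀ ≤ x j}, ⟨⟨i₀, le_rfl⟩, ⟨i, fun h' => hi (le_antisymm hle h')⟩⟩, x i₀,
              fun _ => Iff.rfl, h⟩
          · exact ⟨{j | x i ≤ x j}, ⟨⟨i, le_rfl⟩, ⟨i₀, hle⟩⟩, x i, fun _ => Iff.rfl, h⟩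
      · rintro (⟨heq, h⟩ | ⟨_, _, _, _, h⟩)
        · rwa [← show x = fun _ => x i₀ from funext heq] at h
        · exact h

open FirstOrder

/-! ### Trees as forests -/

section

variable {A : Type} {α : Type u} {t : RelStructure (treeSig A) α}

/-- Since `u` is itself the top of the chain, its strict ancestors form a proper initial segment of
an order of type at most `ω`, which is finite. -/
theorem IsTree.finite_anc (ht : IsTree t) {u : α} (hu : u ∈ t.univ) : {x | t.Anc x u}.Finite := by
  obtain ⟨hwo, hω⟩ := ht.ordinal u hu
  let r : {x // t.Anc x u} → {x // t.Anc x u} → Prop := fun x y => t.Anc x.1 y.1 ∧ x ≠ y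
  let top : {x // t.Anc x u} := ⟨u, ht.refl u hu⟩
  have hlt : Ordinal.typein r top < Ordinal.omega0 := (Ordinal.typein_lt_type r top).trans_le hω
  have hcard : Cardinal.mk {y // r y top} < Cardinal.aleph0 := by
    rw [Ordinal.lt_omega0] at hlt
    obtain ⟨n, hn⟩ := hlt
    have := congrArg Ordinal.card hn
    rw [Ordinal.card_typein, Ordinal.card_nat] at this
    rw [this]
    exact Cardinal.natCast_lt_aleph0
  have hfin : {y | r y top}.Finite := Cardinal.lt_aleph0_iff_finite.1 hcard
  refine ((hfin.insert top).image Subtype.val).subset fun x hx => ⟨⟨x, hx⟩, ?_, rfl⟩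
  by_cases h : (⟨x, hx⟩ : {x // t.Anc x u}) = top
  · exact .inl h
  · exact .inr ⟨hx, h⟩

/-- The forest of a tree. -/
def IsTree.forest (ht : IsTree t) : Forest.{u} where
  carrier := t.univ
  order :=
    { le := fun x y => t.Anc x.1 y.1
      le_refl := fun x => ht.refl x.1 x.2
      le_trans := fun _ _ _ => ht.trans _ _ _
      le_antisymm := fun _ _ h h' => Subtype.ext (ht.antisymm _ _ h h') }
  finite_Iic x := Set.Finite.of_finite_image
    ((ht.finite_anc x.2).subset (by rintro _ ⟨y, hy, rfl⟩; exact hy)) Subtype.val_injective.injOn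
  chain x y z hx hy := by
    obtain ⟨hwo, -⟩ := ht.ordinal z.1 z.2
    rcases hwo.trichotomous ⟨x.1, hx⟩ ⟨y.1, hy⟩ with h
    by_contra hn
    rw [not_or] at hn
    have := h (fun h => hn.1 h.1) (fun h => hn.2 h.1)
    rw [Subtype.mk.injEq] at this
    exact hn.1 (show t.Anc x.1 y.1 from this ▸ ht.refl x.1 x.2)

theorem IsTree.nonempty_forest (ht : IsTree t) : Nonempty ht.forest := by
  obtain ⟨r, hr, -⟩ := ht.root
  exact ⟨⟨r, hr⟩⟩

/-- The symbol of the ancestor relation. -/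
def ancSymbol (A : Type) : (treeSig A).Relations 2 := Sum.inl Language.orderRel.le

/-- The symbol of a label. -/
def labelSymbol {A : Type} (a : A) : (treeSig A).Relations 1 := Sum.inr (.mk a)

/-- The symbol of a mark. -/
def markSymbol (A : Type) {B : Type} (b : B) : ((treeSig A).sum (unary B)).Relations 1 :=
  Sum.inr (.mk b)

/-- The label sets of a tree. -/
def RelStructure.labels (t : RelStructure (treeSig A) α) (a : A) : Set t.univ :=
  {x | (fun _ => x.1) ∈ t.rel (labelSymbol a)}

theorem relMap_le (ht : IsTree t) (x : Fin 2 → t.univ) :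
    Language.Structure.RelMap (ancSymbol A) x ↔
      (show ht.forest from x 0) ≤ x 1 := by
  change (fun i => (x i).1) ∈ t.rel _ ↔ ![(x 0).1, (x 1).1] ∈ t.rel _
  rw [show (fun i => (x i).1) = ![(x 0).1, (x 1).1] by
    funext i
    fin_cases i <;> rfl]
  exact Iff.rfl

theorem relMap_label (a : A) (x : Fin 1 → t.univ) :
    Language.Structure.RelMap (labelSymbol a) x ↔
      x 0 ∈ t.labels a := by
  change (fun i => (x i).1) ∈ t.rel _ ↔ (fun _ => (x 0).1) ∈ t.rel _
  rw [show (fun i => (x i).1) = fun _ => (x 0).1 by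
    funext i
    fin_cases i
    rfl]

end

/-! ### Monadic formulas -/

theorem exists_mdef {A : Type} {n m : ℕ} (φ : MSO (treeSig A) n m) :
    ∃ Φ : Pred.{u} (Fin n) (A ⊕ Fin m), MDef Φ ∧
      ∀ (α : Type u) (t : RelStructure (treeSig A) α) (ht : IsTree t) (x : Fin n → t.univ)
        (Y : Fin m → Set t.univ),
        φ.Realize t.univ x Y ↔ Φ ht.forest x (Sum.elim t.labels Y) := by
  induction φ with
  | falsum => exact ⟨_, falsum, fun _ _ _ _ _ => Iff.rfl⟩
  | equal i j => exact ⟨_, Definable.eq i j, fun _ _ _ _ _ => Iff.rfl⟩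
  | rel R y =>
    rcases R with R | R
    · cases R
      exact ⟨_, Definable.le (y 0) (y 1), fun _ _ ht _ _ => relMap_le ht _⟩
    · obtain ⟨a⟩ := R
      exact ⟨_, Definable.mem (y 0) (.inl a), fun _ _ _ _ _ => relMap_label a _⟩
  | mem i X => exact ⟨_, Definable.mem i (.inr X), fun _ _ _ _ _ => Iff.rfl⟩
  | imp _ _ h₁ h₂ =>
    obtain ⟨Φ₁, hΦ₁, h₁⟩ := h₁
    obtain ⟨Φ₂, hΦ₂, h₂⟩ := h₂
    exact ⟨_, hΦ₁.imp hΦ₂, fun α t ht x Y => imp_congr (h₁ α t ht x Y) (h₂ α t ht x Y)⟩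
  | @all n m φ h =>
    obtain ⟨Φ, hΦ, h⟩ := h
    refine ⟨fun T x Y => ∀ a, Φ T (Fin.snoc (α := fun _ => T) x a) Y,
      Definable.all ((hΦ.reindex (Fin.snoc (α := fun _ => Option (Fin n)) some none)).congr
        fun T x Y => ?_), fun α t ht x Y => forall_congr' fun a => h α t ht _ Y⟩
    rw [iff_iff_eq]
    congr 1
    funext j
    refine Fin.lastCases ?_ (fun i => ?_) j <;> simp
  | @allSet n m φ h =>
    obtain ⟨Φ, hΦ, h⟩ := h
    refine ⟨fun T x Y => ∀ Z, Φ T x (Sum.elim (fun l => Y (.inl l))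
        (Fin.snoc (α := fun _ => Set T) (fun j => Y (.inr j)) Z)),
      Definable.allSet trivial ((hΦ.reindexSets (Sum.elim (fun l => some (.inl l))
        (Fin.snoc (α := fun _ => Option (A ⊕ Fin m)) (fun j => some (.inr j)) none))).congr
        fun T x Y => ?_), fun α t ht x Y => forall_congr' fun Z => h α t ht x _⟩
    rw [iff_iff_eq]
    congr 1
    funext o
    rcases o with l | j
    · rfl
    · refine Fin.lastCases ?_ (fun i => ?_) j <;> simp

theorem MDef.exists_mso {A ι κ : Type} {Φ : Pred.{u} ι κ} (hΦ : MDef Φ) {n m : ℕ} (e : ι → Fin n)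
    (g : κ → A ⊕ Fin m) :
    ∃ φ : MSO (treeSig A) n m,
      ∀ (α : Type u) (t : RelStructure (treeSig A) α) (ht : IsTree t) (x : Fin n → t.univ)
        (Y : Fin m → Set t.univ),
        φ.Realize t.univ x Y ↔
          Φ ht.forest (fun i => x (e i)) (fun l => Sum.elim t.labels Y (g l)) := by
  unfold MDef at hΦ
  induction hΦ generalizing n m with
  | falsum => exact ⟨.falsum, fun _ _ _ _ _ => Iff.rfl⟩
  | le i j =>
    exact ⟨.rel (ancSymbol A) ![e i, e j],
      fun _ _ ht _ _ => relMap_le ht _⟩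
  | mem i l =>
    rcases hl : g l with a | X
    · refine ⟨.rel (labelSymbol a) fun _ => e i, fun α t ht x Y => ?_⟩
      change _ ↔ x (e i) ∈ Sum.elim t.labels Y (g l)
      rw [hl]
      exact relMap_label a _
    · refine ⟨.mem (e i) X, fun α t ht x Y => ?_⟩
      change _ ↔ x (e i) ∈ Sum.elim t.labels Y (g l)
      rw [hl]
      exact Iff.rfl
  | mark h => exact h.elim
  | imp _ _ h₁ h₂ =>
    obtain ⟨φ₁, h₁⟩ := h₁ e g
    obtain ⟨φ₂, h₂⟩ := h₂ e g
    exact ⟨.imp φ₁ φ₂, fun α t ht x Y => imp_congr (h₁ α t ht x Y) (h₂ α t ht x Y)⟩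
  | @cons_all ι κ Φ _ h =>
    obtain ⟨φ, h⟩ := h (fun o => o.elim (Fin.last n) fun i => (e i).castSucc) g
    refine ⟨.all φ, fun α t ht x Y => forall_congr' fun a => (h α t ht _ Y).trans ?_⟩
    rw [iff_iff_eq]
    congr 1
    funext o
    cases o <;> (simp; rfl)
  | @cons_allSet ι κ Φ _ _ h =>
    obtain ⟨φ, h⟩ := h e (fun o => o.elim (.inr (Fin.last m)) fun l => Sum.map id Fin.castSucc (g l))
    refine ⟨.allSet φ, fun α t ht x Y => forall_congr' fun Z => (h α t ht x _).trans ?_⟩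
    rw [iff_iff_eq]
    congr 1
    funext o
    rcases o with _ | l
    · exact Fin.snoc_last (α := fun _ => Set t.univ) Z Y
    · change Sum.elim _ _ (Sum.map id Fin.castSucc (g l)) = Sum.elim _ _ (g l)
      rcases g l with a | X
      · rfl
      · exact Fin.snoc_castSucc (α := fun _ => Set t.univ) Z Y X

/-! ### First-order formulas -/

/-- A definition is a finite object. Marks are paired with their index type of sets because
`Definable` allows marks over every such type. -/
theorem FM.exists_finite_marks {ι κ : Type} {Φ : Pred.{u} ι κ} (hΦ : FM Φ) :
    ∃ s : Set (Σ κ : Type, Pred.{u} Unit κ), s.Finite ∧ (∀ p ∈ s, MDef p.2) ∧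
      Definable False (fun κ μ => ⟨κ, μ⟩ ∈ s) Φ := by
  unfold FM at hΦ
  induction hΦ with
  | falsum => exact ⟨∅, Set.finite_empty, by simp, falsum⟩
  | le i j => exact ⟨∅, Set.finite_empty, by simp, .le i j⟩
  | mem i l => exact ⟨∅, Set.finite_empty, by simp, .mem i l⟩
  | mark h i =>
    exact ⟨_, Set.finite_singleton _, by rintro _ rfl; exact h, .mark (Set.mem_singleton _) i⟩
  | imp _ _ h₁ h₂ =>
    obtain ⟨s₁, hs₁, hm₁, h₁⟩ := h₁
    obtain ⟨s₂, hs₂, hm₂, h₂⟩ := h₂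
    exact ⟨s₁ ∪ s₂, hs₁.union hs₂, fun p hp => hp.elim (hm₁ p) (hm₂ p),
      (h₁.mono id fun _ _ => .inl).imp (h₂.mono id fun _ _ => .inr)⟩
  | cons_all _ h =>
    obtain ⟨s, hs, hm, h⟩ := h
    exact ⟨s, hs, hm, h.cons_all⟩
  | cons_allSet hso => exact hso.elim

/-- A marked tree as a first-order structure. -/
structure IsMarked {κ B : Type} (e : B → Σ κ : Type, Pred.{u} Unit κ) (U : Type u)
    [((treeSig κ).sum (unary B)).Structure U] (T : Forest.{u}) (v : U ≃ T) (Y : κ → Set T) :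
    Prop where
  le (a : Fin 2 → U) : Language.Structure.RelMap (L := (treeSig κ).sum (unary B))
    (Sum.inl (ancSymbol κ)) a ↔ v (a 0) ≤ v (a 1)
  label (l : κ) (a : Fin 1 → U) : Language.Structure.RelMap (L := (treeSig κ).sum (unary B))
    (Sum.inl (labelSymbol l)) a ↔ v (a 0) ∈ Y l
  mark (b : B) (a : Fin 1 → U) : Language.Structure.RelMap (markSymbol κ b) a ↔
    ∃ μ : Pred Unit κ, e b = ⟨κ, μ⟩ ∧ μ T (fun _ => v (a 0)) Y

/-- Without set quantifiers the set parameters remain the labels throughout, so every atom is a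
symbol of the marked signature. -/
theorem Definable.exists_formula {B : Type} {e : B → Σ κ : Type, Pred.{u} Unit κ}
    {mk : ∀ κ : Type, Pred.{u} Unit κ → Prop} (he : ∀ κ μ, mk κ μ → ∃ b, e b = ⟨κ, μ⟩)
    {ι κ : Type} {Φ : Pred.{u} ι κ} (hΦ : Definable False mk Φ) {γ : Type} {n : ℕ}
    (f : ι → γ ⊕ Fin n) :
    ∃ φ : ((treeSig κ).sum (unary B)).BoundedFormula γ n,
      ∀ (U : Type u) [((treeSig κ).sum (unary B)).Structure U] (T : Forest.{u}) (v : U ≃ T)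
        (Y : κ → Set T), IsMarked e U T v Y → ∀ (x : γ → U) (y : Fin n → U),
          φ.Realize x y ↔ Φ T (fun i => v (Sum.elim x y (f i))) Y := by
  induction hΦ generalizing n with
  | falsum => exact ⟨⊥, fun _ _ _ _ _ _ _ _ => Iff.rfl⟩
  | @le ι κ i j =>
    refine ⟨Language.Relations.boundedFormula₂ (L := (treeSig κ).sum (unary B))
      (Sum.inl (ancSymbol κ)) (Language.Term.var (f i))
      (Language.Term.var (f j)), fun U _ T v Y h x y => ?_⟩
    exact Language.BoundedFormula.realize_rel₂.trans (h.le _)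
  | @mem ι κ i l =>
    refine ⟨Language.Relations.boundedFormula₁ (L := (treeSig κ).sum (unary B))
      (Sum.inl (labelSymbol l)) (Language.Term.var (f i)), fun U _ T v Y h x y => ?_⟩
    exact Language.BoundedFormula.realize_rel₁.trans (h.label l _)
  | @mark ι κ μ hμ i =>
    obtain ⟨b, hb⟩ := he _ _ hμ
    refine ⟨Language.Relations.boundedFormula₁ 
      (markSymbol κ b) (Language.Term.var (f i)), fun U _ T v Y h x y => ?_⟩
    refine (Language.BoundedFormula.realize_rel₁.trans (h.mark b _)).trans ?_
    rw [hb]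
    constructor
    · rintro ⟨μ', h', hx⟩
      obtain rfl := eq_of_heq (Sigma.mk.inj h').2
      exact hx
    · exact fun hx => ⟨μ, rfl, hx⟩
  | imp _ _ h₁ h₂ =>
    obtain ⟨φ₁, h₁⟩ := h₁ f
    obtain ⟨φ₂, h₂⟩ := h₂ f
    refine ⟨φ₁.imp φ₂, fun U _ T v Y h x y => ?_⟩
    rw [Language.BoundedFormula.realize_imp]
    exact imp_congr (h₁ U T v Y h x y) (h₂ U T v Y h x y)
  | @cons_all ι κ Φ _ h =>
    obtain ⟨φ, h⟩ := h (fun o => o.elim (.inr (Fin.last n)) fun i => Sum.map id Fin.castSucc (f i))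
    refine ⟨φ.all, fun U _ T v Y hU x y => ?_⟩
    rw [Language.BoundedFormula.realize_all]
    have key : ∀ a : U, (fun o : Option ι => v (Sum.elim x (Fin.snoc y a : Fin (n + 1) → U)
        (o.elim (.inr (Fin.last n)) fun i => Sum.map id Fin.castSucc (f i)))) =
          cons (v a) fun i => v (Sum.elim x y (f i)) := by
      intro a
      funext o
      rcases o with _ | i
      · simp
      · rcases hi : f i with c | j <;> simp [hi]
    simp only [fun a => h U T v Y hU x (Fin.snoc y a : Fin (n + 1) → U), key]
    exact v.forall_congr_left.trans (by simp)
  | cons_allSet hso => exact hso.elim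

theorem exists_fm {A : Type} [Finite A] {n : ℕ} (φ : MSO (treeSig A) n 0) :
    ∃ Φ : Pred.{u} (Fin n) A, FM Φ ∧
      ∀ (α : Type u) (t : RelStructure (treeSig A) α) (ht : IsTree t) (x : Fin n → t.univ),
        φ.Realize t.univ x Fin.elim0 ↔ Φ ht.forest x t.labels := by
  obtain ⟨Φ, hΦ, h⟩ := exists_mdef φ
  have hΦ' := hΦ.reindexSets (Sum.elim id Fin.elim0)
  have h' : ∀ (α : Type u) (t : RelStructure (treeSig A) α) (ht : IsTree t) (x : Fin n → t.univ),
      φ.Realize t.univ x Fin.elim0 ↔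
        Φ ht.forest x (fun l => t.labels (Sum.elim id Fin.elim0 l)) := by
    intro α t ht x
    rw [h α t ht, iff_iff_eq]
    congr 1
    funext o
    rcases o with a | j
    exacts [rfl, j.elim0]
  cases n with
  -- A sentence has no argument that could carry a mark. It is read as a unary predicate of an
  -- arbitrary node, and the root guarantees that there is one.
  | zero =>
    refine ⟨_, Definable.ex (Φ := fun T _ a Y =>
      Φ T (fun i => (fun _ : Unit => a) (i.elim0 : Unit)) (fun l => Y (Sum.elim id Fin.elim0 l)))
      ((fm_of_mdef (hΦ'.reindex (fun i : Fin 0 => (i.elim0 : Unit)))).reindex fun _ => none),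
      fun α t ht x => ?_⟩
    rw [h' α t ht]
    have := ht.nonempty_forest
    have hx : ∀ a : ht.forest, (fun i : Fin 0 => (fun _ : Unit => a) (i.elim0 : Unit)) = x :=
      fun _ => funext fun i => i.elim0
    simp only [hx, exists_const]
  | succ n => exact ⟨_, fm_of_mdef hΦ', h'⟩

/-! ### Markings of trees -/

section

variable {A B : Type} {M : MSOMarking (treeSig A) B} {α : Type u} {t : RelStructure (treeSig A) α}

theorem mem_univ_marking (a : α) : a ∈ (M.toInterpretation.apply t).univ ↔ a ∈ t.univ :=
  ⟨fun ⟨h, _⟩ => h, fun h => ⟨h, fun h => h⟩⟩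

/-- A marking keeps the universe of a tree. -/
def markingEquiv (M : MSOMarking (treeSig A) B) (ht : IsTree t) :
    (M.toInterpretation.apply t).univ ≃ ht.forest where
  toFun a := ⟨a.1, (mem_univ_marking a.1).1 a.2⟩
  invFun a := ⟨a.1, (mem_univ_marking a.1).2 a.2⟩
  left_inv _ := rfl
  right_inv _ := rfl

theorem mem_rel_marking {n : ℕ} (R : ((treeSig A).sum (unary B)).Relations n)
    (ht : IsTree t) (x : Fin n → (M.toInterpretation.apply t).univ) :
    Language.Structure.RelMap R x ↔
      (M.toInterpretation.rel R).Realize t.univ (fun i => markingEquiv M ht (x i)) Fin.elim0 :=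
  ⟨fun ⟨_, _, h⟩ => h, fun h => ⟨fun i => (mem_univ_marking _).1 (x i).2, fun _ h => h, h⟩⟩

theorem isMarked_marking {e : B → Σ κ : Type, Pred.{u} Unit κ} (ht : IsTree t)
    (hM : ∀ b (x : Fin 1 → t.univ), (M.mark b).Realize t.univ x Fin.elim0 ↔
      ∃ μ : Pred Unit A, e b = ⟨A, μ⟩ ∧ μ ht.forest (fun _ => x 0) t.labels) :
    IsMarked e (M.toInterpretation.apply t).univ ht.forest (markingEquiv M ht) t.labels where
  le a := (mem_rel_marking (M := M) (Sum.inl (ancSymbol A)) ht a).trans (relMap_le ht _)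
  label l a := (mem_rel_marking (M := M) (Sum.inl (labelSymbol l)) ht a).trans (relMap_label l _)
  mark b a := (mem_rel_marking (M := M) (markSymbol A b) ht a).trans (hM b _)

end

theorem exists_marking {A : Type} [Finite A] {s : Set (Σ κ : Type, Pred.{u} Unit κ)} (hs : s.Finite)
    (hm : ∀ p ∈ s, MDef p.2) :
    ∃ (N : ℕ) (e : Fin N → Σ κ : Type, Pred.{u} Unit κ) (M : MSOMarking (treeSig A) (Fin N)),
      (∀ p ∈ s, ∃ b, e b = p) ∧
      ∀ (α : Type u) (t : RelStructure (treeSig A) α) (ht : IsTree t),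
        IsMarked e (M.toInterpretation.apply t).univ ht.forest (markingEquiv M ht) t.labels := by
  have := hs.to_subtype
  obtain ⟨N, ⟨f⟩⟩ := Finite.exists_equiv_fin s
  let e : Fin N → Σ κ : Type, Pred.{u} Unit κ := fun b => (f.symm b).1
  have hψ : ∀ b : Fin N, ∃ ψ : MSO (treeSig A) 1 0,
      ∀ (α : Type u) (t : RelStructure (treeSig A) α) (ht : IsTree t) (x : Fin 1 → t.univ),
        ψ.Realize t.univ x Fin.elim0 ↔
          ∃ μ : Pred Unit A, e b = ⟨A, μ⟩ ∧ μ ht.forest (fun _ => x 0) t.labels := by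
    intro b
    -- A pair whose index type is not `A` cannot occur over these trees and receives the empty mark,
    -- as `IsMarked` requires.
    by_cases h : ∃ μ : Pred Unit A, e b = ⟨A, μ⟩
    · obtain ⟨μ, hμ⟩ := h
      have hdef : MDef μ := by
        have := hm _ (f.symm b).2
        change MDef (e b).2 at this
        rwa [hμ] at this
      obtain ⟨ψ, hψ⟩ := hdef.exists_mso (A := A) (n := 1) (m := 0) (fun _ => 0) Sum.inl
      refine ⟨ψ, fun α t ht x => (hψ α t ht x _).trans ⟨fun h => ⟨μ, hμ, h⟩, ?_⟩⟩
      rintro ⟨μ', hμ', h⟩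
      obtain rfl := eq_of_heq (Sigma.mk.inj (hμ.symm.trans hμ')).2
      exact h
    · exact ⟨.falsum, fun α t ht x => ⟨False.elim, fun ⟨μ, hμ, _⟩ => h ⟨μ, hμ⟩⟩⟩
  choose ψ hψ using hψ
  exact ⟨N, e, ⟨ψ⟩, fun p hp => ⟨f ⟨p, hp⟩, by simp [e]⟩,
    fun α t ht => isMarked_marking ht fun b x => hψ b α t ht x⟩

theorem exists_interpretation {A : Type} [Finite A] {L' : FirstOrder.Language.{0, 0}}
    [Finite (Σ n, L'.Relations n)] (I : MSOInterpretation (treeSig A) L') :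
    ∃ (N : ℕ) (M : MSOMarking (treeSig A) (Fin N))
      (J : FOInterpretation ((treeSig A).sum (unary (Fin N))) L'),
      ∀ (α : Type u) (t : RelStructure (treeSig A) α),
        IsTree t → I.apply t = J.apply (M.toInterpretation.apply t) := by
  obtain ⟨Φ, hΦ, h⟩ := exists_fm.{u} I.dom
  choose Ψ hΨ h' using fun R : Σ n, L'.Relations n => exists_fm.{u} (I.rel R.2)
  obtain ⟨s, hs, hm, hd⟩ := hΦ.exists_finite_marks
  choose s' hs' hm' hd' using fun R => (hΨ R).exists_finite_marks
  -- A single marking must serve the domain formula and all relations; the union is finite because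
  -- there are finitely many relation names.
  obtain ⟨N, e, M, he, hM⟩ := exists_marking (A := A) (s := s ∪ ⋃ R, s' R)
    (hs.union (Set.finite_iUnion hs')) (by
      rintro p (hp | hp)
      · exact hm p hp
      · obtain ⟨R, hp⟩ := Set.mem_iUnion.1 hp
        exact hm' R p hp)
  obtain ⟨φ, hφ⟩ := Definable.exists_formula (e := e) (fun κ μ h => he _ (.inl h)) hd
    (γ := Fin 1) (n := 0) Sum.inl
  choose ψ hψ using fun R : Σ n, L'.Relations n => Definable.exists_formula (e := e)
    (fun κ μ h => he _ (.inr (Set.mem_iUnion.2 ⟨R, h⟩))) (hd' R) (γ := Fin R.1) (n := 0) Sum.inl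
  refine ⟨N, M, ⟨φ, fun {n} R => ψ ⟨n, R⟩⟩, fun α t ht => ?_⟩
  have hdom : ∀ x : Fin 1 → (M.toInterpretation.apply t).univ,
      Language.Formula.Realize φ x ↔
        I.dom.Realize t.univ (fun i => markingEquiv M ht (x i)) Fin.elim0 := fun x =>
    (hφ _ _ _ _ (hM α t ht) x default).trans (h α t ht _).symm
  have hrel : ∀ (R : Σ n, L'.Relations n) (x : Fin R.1 → (M.toInterpretation.apply t).univ),
      Language.Formula.Realize (ψ R) x ↔
        (I.rel R.2).Realize t.univ (fun i => markingEquiv M ht (x i)) Fin.elim0 := fun R x =>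
    (hψ R _ _ _ _ (hM α t ht) x default).trans (h' R α t ht _).symm
  refine RelStructure.ext (Set.ext fun a => ?_) ?_
  · constructor
    · rintro ⟨ha, h⟩
      exact ⟨(mem_univ_marking a).2 ha, (hdom _).2 h⟩
    · rintro ⟨ha, h⟩
      exact ⟨(mem_univ_marking a).1 ha, (hdom _).1 h⟩
  · funext n R
    refine Set.ext fun x => ?_
    constructor
    · rintro ⟨hx, hδ, h⟩
      exact ⟨fun i => (mem_univ_marking _).2 (hx i), fun i => (hdom _).2 (hδ i),
        (hrel ⟨n, R⟩ _).2 h⟩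
    · rintro ⟨hx, hδ, h⟩
      exact ⟨fun i => (mem_univ_marking _).1 (hx i), fun i => (hdom _).1 (hδ i),
        (hrel ⟨n, R⟩ _).1 h⟩

end TreeInterp

theorem theorem6p5 {A : Type} [Finite A] {L' : FirstOrder.Language.{0, 0}} [L'.IsRelational]
    [Finite (Σ n, L'.Relations n)] (I : TreeInterp.MSOInterpretation (TreeInterp.treeSig A) L') :
    ∃ (N : ℕ) (M : TreeInterp.MSOMarking (TreeInterp.treeSig A) (Fin N))
      (J : TreeInterp.FOInterpretation
        ((TreeInterp.treeSig A).sum (TreeInterp.unary (Fin N))) L'),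
      ∀ (α : Type*) (t : TreeInterp.RelStructure (TreeInterp.treeSig A) α),
        TreeInterp.IsTree t → I.apply t = J.apply (M.toInterpretation.apply t) :=
  TreeInterp.exists_interpretation I
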